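/- **Definitions.** Let $\mathbb N=\{1,2,\dots\}$. An infinite binary information system is a pair $U=(A,F)$ of an infinite set $A$ (objects) and an infinite set $F$ of functions $A\to\{0,1\}$ (attributes). A problem over $U$ is a tuple $z=(\nu,f_1,\dots,f_n)$ with $n\in\mathbb N$, $\nu:\{0,1\}^n\to\mathbb N$, $f_1,\dots,f_n\in F$; put $\dim z=n$ and $z(a)=\nu(f_1(a),\dots,f_n(a))$ for $a\in A$. A decision tree over $U$ is a finite rooted directed tree in which the root is not a terminal node, the root and the edges leaving it are unlabeled, each terminal node is labeled with a number from $\mathbb N$, each working node (neither the root nor terminal) is labeled with an attribute from $F$, and each edge leaving a working node is labeled with $0$ or $1$. It is deterministic if exactly one edge leaves the root and the edges leaving any working node have different labels. A complete path $\xi$ leads from the root to a terminal node; $A(\xi)$ is the set of $a\in A$ such that $f(a)=\delta$ for every working node of $\xi$, where $f$ is its attribute and $\delta$ is the label of the edge by which $\xi$ leaves it. The tree solves $z$ nondeterministically if every $a\in A$ lies in $A(\xi)$ for some complete path $\xi$, and whenever $a\in A(\xi)$ the terminal node of $\xi$ is labeled with $z(a)$; it solves $z$ deterministically if, moreover, it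 is deterministic. The depth $h(\Gamma)$ is the maximum number of working nodes in a complete path, and $L(\Gamma)$ is the number of all nodes of $\Gamma$. Let $h_U^d(z)$, $L_U^d(z)$ (respectively $h_U^a(z)$, $L_U^a(z)$) be the minimum depth and the minimum number of nodes of a decision tree over $U$ solving $z$ deterministically (respectively nondeterministically), and let $h_U^d(n),L_U^d(n),h_U^a(n),L_U^a(n)$ be the maxima of these numbers over all problems $z$ over $U$ with $\dim z\le n$. A finite set $S\subseteq F$ is independent if every assignment $S\to\{0,1\}$ equals $f\mapsto f(a)$ for some $a\in A$; $I(U)\in\mathbb N\cup\{0,\infty\}$ is the supremum of the cardinalities of independent finite subsets of $F$. $W_1$ is the class of infinite binary information systems $U$ of type (LOG, CON, POL, POL), that is: - for every $0<\varepsilon<1$ there is $c>0$ with $\log_2(n+1)\le h_U^d(n)\le c(\log_2 n)^{1+\varepsilon}+1$ for all $n\in\mathbb N$; - there is $c>0$ with $h_U^a(n)\le c$ for all $n\in\mathbb N$; - $I(U)<\infty$, and $2(n+1)\le L_U^d(n)\le 2(4n)^{I(U)}$ and $2(n+1)\le L_U^a(n)\le 2(4n)^{I(U)}$ for all $n\in\mathbb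 N$. A pair $(\varphi,\psi)$ of real-valued functions on $\mathbb N$ is a boundary $d$-pair (respectively boundary $a$-pair) of $U$ if for every problem $z$ over $U$ there is a decision tree $\Gamma$ over $U$ that solves $z$ deterministically (respectively nondeterministically) with $h(\Gamma)\le\varphi(\dim z)$ and $L(\Gamma)\le\psi(\dim z)$. $U$ is $d$-reachable if $(h_U^d,L_U^d)$ is a boundary $d$-pair of $U$, and $a$-reachable if $(h_U^a,L_U^a)$ is a boundary $a$-pair of $U$. Let $U_1=(\mathbb N,\{l_i:i\in\mathbb N\})$, where $l_i(j)=1$ iff $j>i$. Let $U_6=(\mathbb R_{\ge0},\{p_i:i\in\mathbb N\}\cup\{q_i:i\in\mathbb N\})$, where $p_i(a)=1$ iff $a=i$, and $q_i(a)=1$ iff $a\ge i+\tfrac12$. **Theorem 2.** (a) The class $W_1$ contains both $d$-reachable systems and systems that are not $d$-reachable: $U_1\in W_1$ is $d$-reachable, and $U_6\in W_1$ is not $d$-reachable. If $U\in W_1$ is not $d$-reachable, then for each $\varepsilon$ with $0<\varepsilon<1$ there is a constant $c>0$ such that $$\bigl(c(\log_2 n)^{1+\varepsilon}+1,\ 2^{c(\log_2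 n)^{1+\varepsilon}+2}\bigr)$$ is a boundary $d$-pair of $U$. (b) If $U\in W_1$, then $U$ is not $a$-reachable, and for each $\varepsilon$ with $0<\varepsilon<1$ there are constants $c_1,c_2,c_3>0$ such that $$\bigl(c_1,\ 2^{c_2(\log_2 n)^{1+\varepsilon}+c_3}\bigr)$$ is a boundary $a$-pair of $U$. -/

import Mathlib

open scoped NNReal

universe u

noncomputable section

/-- An infinite binary information system `(A, F)`: an infinite set `A` of objects and an infinite
set `F` of attributes `A → {0, 1}` (with `{0, 1}` modelled by `Bool`). -/
structure InfoSystem where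
  A : Type u
  F : Set (A → Bool)
  infinite_objects : Infinite A
  infinite_attributes : F.Infinite

namespace InfoSystem

/-- A problem `(ν, f₁, …, fₙ)`, `n ≥ 1`, with `ν : {0,1}ⁿ → {1, 2, …}`. -/
structure Problem (U : InfoSystem) where
  dim : ℕ
  dim_pos : 0 < dim
  ν : (Fin dim → Bool) → ℕ+
  f : Fin dim → U.F

/-- The value `z(a) = ν(f₁(a), …, fₙ(a))`. -/
def Problem.value {U : InfoSystem} (z : U.Problem) (a : U.A) : ℕ+ :=
  z.ν fun i => (z.f i).1 a

/-- A node of a decision tree different from the root, together with everything below it.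
A terminal node carries a positive integer; a working node carries an attribute and has
`k + 1 ≥ 1` leaving edges, the `i`-th one labeled with `lab i` and entering `child i`. -/
inductive Node (U : InfoSystem)
  | terminal (label : ℕ+) : Node U
  | working (f : U.F) (k : ℕ) (lab : Fin (k + 1) → Bool) (child : Fin (k + 1) → Node U) : Node U

namespace Node

variable {U : InfoSystem}

/-- Number of nodes. -/
def size : Node U → ℕ
  | terminal _ => 1
  | working _ _ _ child => 1 + ∑ i, (child i).size

/-- Maximum number of working nodes on a path down to a terminal node. -/
def depth : Node U → ℕ
  | terminal _ => 0
  | working _ _ _ child => 1 + Finset.univ.sup fun i => (child i).depth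

/-- Edges leaving a working node are labeled with different numbers. -/
def Deterministic : Node U → Prop
  | terminal _ => True
  | working _ _ lab child => Function.Injective lab ∧ ∀ i, (child i).Deterministic

/-- `v.IsPath e s`: some directed path from `v` to a terminal node labeled with `s` passes
successively through working nodes and edges with the (attribute, number) pairs listed in `e`. -/
inductive IsPath : Node U → List (U.F × Bool) → ℕ+ → Prop
  | terminal (s : ℕ+) : IsPath (.terminal s) [] s
  | working (f : U.F) (k : ℕ) (lab : Fin (k + 1) → Bool) (child : Fin (k + 1) → Node U)
      (i : Fin (k + 1)) (e : List (U.F × Bool)) (s : ℕ+) (h : IsPath (child i) e s) :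
      IsPath (.working f k lab child) ((f, lab i) :: e) s

end Node

/-- A decision tree: an unlabeled root with `k + 1 ≥ 1` unlabeled leaving edges. -/
structure DTree (U : InfoSystem) where
  k : ℕ
  child : Fin (k + 1) → Node U

namespace DTree

variable {U : InfoSystem}

/-- `L(Γ)`: the number of nodes, the root included. -/
def size (Γ : DTree U) : ℕ := 1 + ∑ i, (Γ.child i).size

/-- `h(Γ)`: the maximum number of working nodes in a complete path. -/
def depth (Γ : DTree U) : ℕ := Finset.univ.sup fun i => (Γ.child i).depth

/-- Only one edge leaves the root, and edges leaving a working node have different labels. -/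
def Deterministic (Γ : DTree U) : Prop := Γ.k = 0 ∧ ∀ i, (Γ.child i).Deterministic

/-- Complete paths, given by their list of equations and the label of the terminal node. -/
def IsCompletePath (Γ : DTree U) (e : List (U.F × Bool)) (s : ℕ+) : Prop :=
  ∃ i, (Γ.child i).IsPath e s

end DTree

/-- The set of solutions in `A` of a system of equations `f(x) = δ`. -/
def solutions (U : InfoSystem) (e : List (U.F × Bool)) : Set U.A :=
  {a | ∀ p ∈ e, p.1.1 a = p.2}

/-- `Γ` solves `z` nondeterministically. -/
def DTree.SolvesA {U : InfoSystem} (Γ : DTree U) (z : U.Problem) : Prop :=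
  (∀ a : U.A, ∃ e s, Γ.IsCompletePath e s ∧ a ∈ U.solutions e) ∧
  ∀ (a : U.A) (e : List (U.F × Bool)) (s : ℕ+),
    Γ.IsCompletePath e s → a ∈ U.solutions e → s = z.value a

/-- `Γ` solves `z` deterministically. -/
def DTree.SolvesD {U : InfoSystem} (Γ : DTree U) (z : U.Problem) : Prop :=
  Γ.Deterministic ∧ Γ.SolvesA z

variable (U : InfoSystem)

/-- `h_U^d(z)`, a minimum over a nonempty set of natural numbers. -/
def hdProblem (z : U.Problem) : ℕ := sInf {m | ∃ Γ : DTree U, Γ.SolvesD z ∧ Γ.depth = m}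

/-- `h_U^a(z)` -/
def haProblem (z : U.Problem) : ℕ := sInf {m | ∃ Γ : DTree U, Γ.SolvesA z ∧ Γ.depth = m}

/-- `L_U^d(z)` -/
def LdProblem (z : U.Problem) : ℕ := sInf {m | ∃ Γ : DTree U, Γ.SolvesD z ∧ Γ.size = m}

/-- `L_U^a(z)` -/
def LaProblem (z : U.Problem) : ℕ := sInf {m | ∃ Γ : DTree U, Γ.SolvesA z ∧ Γ.size = m}

/-- `h_U^d(n)`, the maximum over the problems of dimension at most `n` (the set is bounded by `n`,
because one can query all attributes of a problem one after another). -/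
def hd (n : ℕ) : ℕ := sSup {m | ∃ z : U.Problem, z.dim ≤ n ∧ U.hdProblem z = m}

/-- `h_U^a(n)` (bounded by `n`) -/
def ha (n : ℕ) : ℕ := sSup {m | ∃ z : U.Problem, z.dim ≤ n ∧ U.haProblem z = m}

/-- `L_U^d(n)` (bounded by `2 ^ (n + 1)`) -/
def Ld (n : ℕ) : ℕ := sSup {m | ∃ z : U.Problem, z.dim ≤ n ∧ U.LdProblem z = m}

/-- `L_U^a(n)` (bounded by `2 ^ (n + 1)`) -/
def La (n : ℕ) : ℕ := sSup {m | ∃ z : U.Problem, z.dim ≤ n ∧ U.LaProblem z = m}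

/-- A finite set of functions is independent if every assignment of values to its members is
attained at some object. -/
def Independent (S : Finset (U.A → Bool)) : Prop :=
  ∀ δ : (U.A → Bool) → Bool, ∃ a : U.A, ∀ f ∈ S, f a = δ f

/-- The independence dimension `I(U)`, the supremum of the cardinalities of independent finite
subsets of `F`. -/
def iDim : ℕ∞ :=
  ⨆ (S : Finset (U.A → Bool)) (_ : (S : Set (U.A → Bool)) ⊆ U.F ∧ U.Independent S), (S.card : ℕ∞)

/-- The type of behavior LOG of a function on `{1, 2, …}`. -/
def IsLOG (h : ℕ → ℕ) : Prop :=
  ∀ ε : ℝ, 0 < ε → ε < 1 → ∃ c : ℝ, 0 < c ∧ ∀ n : ℕ, 1 ≤ n →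
    Real.logb 2 ((n : ℝ) + 1) ≤ h n ∧ (h n : ℝ) ≤ c * (Real.logb 2 n) ^ (1 + ε) + 1

/-- The type of behavior CON of a function on `{1, 2, …}`. -/
def IsCON (h : ℕ → ℕ) : Prop :=
  ∃ c : ℝ, 0 < c ∧ ∀ n : ℕ, 1 ≤ n → (h n : ℝ) ≤ c

/-- The type of behavior POL of a function on `{1, 2, …}` attached to `U`: the dimension `I(U)` is
finite and `2 (n + 1) ≤ L(n) ≤ 2 (4 n) ^ I(U)`. -/
def IsPOL (L : ℕ → ℕ) : Prop :=
  ∃ d : ℕ, U.iDim = d ∧ ∀ n : ℕ, 1 ≤ n → 2 * (n + 1) ≤ L n ∧ L n ≤ 2 * (4 * n) ^ d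

/-- The class `W₁`: systems of type (LOG, CON, POL, POL). -/
def InW1 : Prop := IsLOG U.hd ∧ IsCON U.ha ∧ U.IsPOL U.Ld ∧ U.IsPOL U.La

/-- Boundary `d`-pairs. The bounds may be real-valued; as depth and number of nodes are integers,
this is the same as taking the integer parts of the bounds. -/
def IsBoundaryDPair (φ ψ : ℕ → ℝ) : Prop :=
  ∀ z : U.Problem, ∃ Γ : DTree U, Γ.SolvesD z ∧ (Γ.depth : ℝ) ≤ φ z.dim ∧ (Γ.size : ℝ) ≤ ψ z.dim

/-- Boundary `a`-pairs. -/
def IsBoundaryAPair (φ ψ : ℕ → ℝ) : Prop :=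
  ∀ z : U.Problem, ∃ Γ : DTree U, Γ.SolvesA z ∧ (Γ.depth : ℝ) ≤ φ z.dim ∧ (Γ.size : ℝ) ≤ ψ z.dim

def DReachable : Prop := U.IsBoundaryDPair (fun n => U.hd n) (fun n => U.Ld n)

def AReachable : Prop := U.IsBoundaryAPair (fun n => U.ha n) (fun n => U.La n)

/-- `l_i(j) = 1` iff `j > i`, on positive integers. -/
def attrL (i j : ℕ+) : Bool := decide (i < j)

/-- `p_i(a) = 1` iff `a = i`, on nonnegative reals. -/
def attrP (i : ℕ+) (a : ℝ≥0) : Bool := decide (a = ((i : ℕ) : ℝ≥0))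

/-- `q_i(a) = 1` iff `a ≥ i + 1/2`, on nonnegative reals. -/
def attrQ (i : ℕ+) (a : ℝ≥0) : Bool := decide (((i : ℕ) : ℝ≥0) + 1 / 2 ≤ a)

theorem attrL_injective : Function.Injective attrL := by
  intro i j h
  have h1 := congrFun h i
  have h2 := congrFun h j
  simp only [attrL, decide_eq_decide, lt_irrefl] at h1 h2
  grind

theorem attrP_injective : Function.Injective attrP := by
  intro i j h
  have h1 := congrFun h ((i : ℕ) : ℝ≥0)
  simpa [attrP] using h1

/-- The system with objects `{1, 2, …}` and attributes `l_i`, `i ≥ 1`. -/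
def U₁ : InfoSystem.{0} where
  A := ℕ+
  F := Set.range attrL
  infinite_objects := inferInstance
  infinite_attributes := Set.infinite_range_of_injective attrL_injective

/-- The system with objects the nonnegative reals and attributes `p_i`, `q_i`, `i ≥ 1`. -/
def U₆ : InfoSystem.{0} where
  A := ℝ≥0
  F := Set.range attrP ∪ Set.range attrQ
  infinite_objects := inferInstance
  infinite_attributes := (Set.infinite_range_of_injective attrP_injective).mono
    Set.subset_union_left

end InfoSystem

end

/-! The theorem compares depth with number of nodes. A deterministic tree of depth $h$ has at most
$2^{h+1}$ nodes, so a tree of minimum depth already yields the boundary $d$-pair.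

For nondeterministic trees the key is shortening systems of equations. Whether a system of $m$
equations holds is a problem of dimension $m$, so its solution set is a union of at most
$2^{h^d(m)}$ solution sets of systems of length at most $h^d(m)$ (`exists_cover`). LOG gives
$2h^d(m)\le m$ beyond some $M$, so iteration reaches the constant length $M$ (`exists_short_cover`).
Applied to the paths of a depth-optimal deterministic tree, this gives depth at most $M$ with
$2^{O(h^d(n)+1)}$ nodes (`Problem.exists_shallow_solvesA`).

Against $a$-reachability: attributes realizing $N$ tuples never require more than $2N$ nodes,
whereas a tree with at most $2N$ nodes that identifies all $N$ tuples has so few working nodes that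
$N\le 2^{h}$, as for deterministic trees (`Node.card_values_le`). Since $L^a$ is unbounded, $N$ can
be made too large for a constant depth (`not_AReachable`).

In $U_1$ and $U_6$ no two attributes are independent, so $n$ attributes realize at most $n+1$
tuples, and binary search keeps the depth logarithmic. In $U_1$ the search tree is also smallest. In
$U_6$, identifying $p_1,\dots,p_n$ with fewest nodes leaves room for these attributes only, and the
object $0$ must then pass all of them, at depth $n$. -/

namespace InfoSystem

/-! ### Subtrees: paths, working nodes and the cost of seeing many values -/

namespace Node

variable {U : InfoSystem.{u}}

/-- The attributes at the working nodes, with multiplicity. -/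
noncomputable def attrs : Node U → Multiset U.F
  | terminal _ => 0
  | working f _ _ child => f ::ₘ ∑ i, (child i).attrs

/-- The paths to terminal nodes, with multiplicity. -/
noncomputable def paths : Node U → Multiset (List (U.F × Bool) × ℕ+)
  | terminal s => {([], s)}
  | working f _ lab child => ∑ i, (child i).paths.map fun p => ((f, lab i) :: p.1, p.2)

theorem mem_paths {v : Node U} {e : List (U.F × Bool)} {s : ℕ+} :
    (e, s) ∈ v.paths ↔ v.IsPath e s := by
  induction v generalizing e s with
  | terminal t =>
    simp only [paths, Multiset.mem_singleton, Prod.mk.injEq]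
    constructor
    · rintro ⟨rfl, rfl⟩
      exact .terminal _
    · rintro ⟨⟩
      exact ⟨rfl, rfl⟩
  | working f k lab child ih =>
    simp only [paths, Multiset.mem_sum, Finset.mem_univ, true_and, Multiset.mem_map, Prod.exists,
      Prod.mk.injEq]
    constructor
    · rintro ⟨i, e, s, h, rfl, rfl⟩
      exact .working _ _ _ _ _ _ _ ((ih i).1 h)
    · rintro ⟨⟩
      rename_i e i h
      exact ⟨i, e, s, (ih i).2 h, rfl, rfl⟩

theorem isPath_terminal {t : ℕ+} {e : List (U.F × Bool)} {s : ℕ+} :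
    (terminal t : Node U).IsPath e s ↔ e = [] ∧ s = t := by
  rw [← mem_paths]
  simp [paths]

theorem isPath_working {f : U.F} {k : ℕ} {lab : Fin (k + 1) → Bool} {child : Fin (k + 1) → Node U}
    {e : List (U.F × Bool)} {s : ℕ+} :
    (working f k lab child).IsPath e s ↔ ∃ i e', (child i).IsPath e' s ∧ e = (f, lab i) :: e' := by
  constructor
  · rintro ⟨⟩
    rename_i e i h
    exact ⟨i, e, h, rfl⟩
  · rintro ⟨i, e, h, rfl⟩
    exact .working _ _ _ _ _ _ _ h

theorem size_eq (v : Node U) : v.size = v.attrs.card + v.paths.card := by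
  induction v with
  | terminal t => simp [size, attrs, paths]
  | working f k lab child ih =>
    simp only [size, attrs, paths, ih, Multiset.card_cons, Multiset.card_sum, Multiset.card_map,
      Finset.sum_add_distrib]
    ring

theorem IsPath.length_le_depth {v : Node U} {e : List (U.F × Bool)} {s : ℕ+} (h : v.IsPath e s) :
    e.length ≤ v.depth := by
  induction h with
  | terminal s => simp
  | working f k lab child i e s h ih =>
    have := Finset.le_sup (f := fun i => (child i).depth) (Finset.mem_univ i)
    simp only [depth, List.length_cons]
    omega

theorem IsPath.mem_attrs {v : Node U} {e : List (U.F × Bool)} {s : ℕ+} (h : v.IsPath e s)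
    {p : U.F × Bool} (hp : p ∈ e) : p.1 ∈ v.attrs := by
  induction h with
  | terminal s => simp at hp
  | working f k lab child i e s h ih =>
    simp only [attrs, Multiset.mem_cons, Multiset.mem_sum]
    rcases List.mem_cons.1 hp with rfl | hp
    · exact .inl rfl
    · exact .inr ⟨i, Finset.mem_univ i, ih hp⟩

theorem arity_le_two {k : ℕ} {lab : Fin (k + 1) → Bool} (h : Function.Injective lab) :
    k + 1 ≤ 2 := by
  simpa using Fintype.card_le_of_injective lab h

theorem Deterministic.card_paths_le {v : Node U} (h : v.Deterministic) :
    v.paths.card ≤ 2 ^ v.depth := by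
  induction v with
  | terminal t => simp [paths, depth]
  | working f k lab child ih =>
    simp only [paths, depth, Multiset.card_sum, Multiset.card_map, pow_add, pow_one]
    calc ∑ i, (child i).paths.card
        ≤ ∑ _i : Fin (k + 1), 2 ^ (Finset.univ.sup fun i => (child i).depth) := by
          refine Finset.sum_le_sum fun i _ => (ih i (h.2 i)).trans ?_
          exact Nat.pow_le_pow_right (by norm_num)
            (Finset.le_sup (f := fun i => (child i).depth) (Finset.mem_univ i))
      _ ≤ _ := by
          rw [Finset.sum_const, Finset.card_univ, Fintype.card_fin, smul_eq_mul]
          exact Nat.mul_le_mul_right _ (arity_le_two h.1)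

/-- The spare node on the left makes the induction close and later pays for the root of the whole
tree. -/
theorem Deterministic.size_lt {v : Node U} (h : v.Deterministic) :
    v.size + 1 ≤ 2 ^ (v.depth + 1) := by
  induction v with
  | terminal t => simp [size, depth]
  | working f k lab child ih =>
    have h1 : ∑ i, ((child i).size + 1) ≤
        ∑ _i : Fin (k + 1), 2 ^ ((Finset.univ.sup fun i => (child i).depth) + 1) := by
      refine Finset.sum_le_sum fun i _ => (ih i (h.2 i)).trans ?_
      exact Nat.pow_le_pow_right (by norm_num) (Nat.succ_le_succ
        (Finset.le_sup (f := fun i => (child i).depth) (Finset.mem_univ i)))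
    rw [Finset.sum_add_distrib, Finset.sum_const, Finset.sum_const, Finset.card_univ,
      Fintype.card_fin, smul_eq_mul, smul_eq_mul, mul_one] at h1
    have h2 := arity_le_two h.1
    simp only [size, depth]
    rw [show 1 + (Finset.univ.sup fun i => (child i).depth) + 1 =
      ((Finset.univ.sup fun i => (child i).depth) + 1) + 1 by ring, pow_succ 2 (_ + 1)]
    have h3 : 1 ≤ 2 ^ ((Finset.univ.sup fun i => (child i).depth) + 1) := Nat.one_le_two_pow
    obtain hk | hk : k = 0 ∨ k = 1 := by omega
    · subst hk
      omega
    · subst hk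
      omega

/-- Every object of `X` follows some path of `v`, and all paths it follows end in its value. -/
def Computes (v : Node U) (X : Set U.A) (val : U.A → ℕ+) : Prop :=
  ∀ a ∈ X, (∃ e s, v.IsPath e s ∧ a ∈ U.solutions e) ∧
    ∀ e s, v.IsPath e s → a ∈ U.solutions e → s = val a

theorem computes_terminal {X : Set U.A} {val : U.A → ℕ+} {s : ℕ+} (h : ∀ a ∈ X, val a = s) :
    (terminal s : Node U).Computes X val := by
  intro a ha
  refine ⟨⟨[], s, .terminal s, by simp [solutions]⟩, fun e t he _ => ?_⟩
  rw [(isPath_terminal.1 he).2, h a ha]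

/-- A working node with one leaving edge for each of the two answers. -/
def query (f : U.F) (v : Bool → Node U) : Node U :=
  working f 1 (fun i => decide (i = 1)) fun i => v (decide (i = 1))

theorem depth_query (f : U.F) (v : Bool → Node U) :
    (query f v).depth = 1 + max (v false).depth (v true).depth := by
  simp [query, depth, Fin.univ_succ]

theorem size_query (f : U.F) (v : Bool → Node U) :
    (query f v).size = 1 + ((v false).size + (v true).size) := by
  simp [query, size, Fin.sum_univ_two]

theorem deterministic_query {f : U.F} {v : Bool → Node U} (h : ∀ b, (v b).Deterministic) :
    (query f v).Deterministic := by
  refine ⟨?_, fun i => h _⟩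
  intro i j hij
  fin_cases i <;> fin_cases j <;> simp_all

theorem computes_query {f : U.F} {v : Bool → Node U} {X : Set U.A} {val : U.A → ℕ+}
    (h : ∀ b, (v b).Computes {a ∈ X | f.1 a = b} val) : (query f v).Computes X val := by
  intro a ha
  obtain ⟨⟨e, s, hp, hs⟩, hu⟩ := h (f.1 a) a ⟨ha, rfl⟩
  constructor
  · have key : ∃ i : Fin 2, decide (i = 1) = f.1 a := by
      cases f.1 a
      · exact ⟨0, by simp⟩
      · exact ⟨1, by simp⟩
    obtain ⟨i, hi⟩ := key
    refine ⟨(f, decide (i = 1)) :: e, s, isPath_working.2 ⟨i, e, by rwa [hi], rfl⟩, ?_⟩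
    intro p hp
    rcases List.mem_cons.1 hp with rfl | hp
    · exact hi.symm
    · exact hs p hp
  · intro e s hp hs
    obtain ⟨i, e, hp', rfl⟩ := isPath_working.1 hp
    have hi : f.1 a = decide (i = 1) := hs (f, _) (List.mem_cons_self ..)
    rw [← hi] at hp'
    exact hu e s hp' fun p hp => hs p (List.mem_cons_of_mem _ hp)

/-- An object follows a path containing an attribute that separates it from a given object with
a different value. -/
theorem Computes.exists_separating {v : Node U} {X : Set U.A} {val : U.A → ℕ+}
    (h : v.Computes X val) {a b : U.A} (hb : b ∈ X) (hab : val a ≠ val b)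
    {e : List (U.F × Bool)} (he : v.IsPath e (val a)) (hs : a ∈ U.solutions e) :
    ∃ p ∈ e, p.1.1 a ≠ p.1.1 b := by
  by_contra! hc
  exact hab ((h b hb).2 e _ he fun p hp => (hc p hp) ▸ hs p hp)

open Classical in
/-- A node that sees few values under `X` but has even fewer working nodes must act like a
deterministic one. -/
theorem card_values_le {v : Node U} {X : Set U.A} {val : U.A → ℕ+}
    (h : ∀ a ∈ X, ∀ e s, v.IsPath e s → a ∈ U.solutions e → s = val a) (V : Finset ℕ+) :
    (V.filter fun t => ∃ a ∈ X, val a = t ∧ ∃ e s, v.IsPath e s ∧ a ∈ U.solutions e).card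
        ≤ v.attrs.card ∨
      (V.filter fun t => ∃ a ∈ X, val a = t).card ≤ v.attrs.card + 1 ∧
      (V.filter fun t => ∃ a ∈ X, val a = t).card ≤ 2 ^ v.depth := by
  induction v generalizing X with
  | terminal s =>
    right
    have h1 : (V.filter fun t => ∃ a ∈ X, val a = t).card ≤ 1 := by
      rw [← Finset.card_singleton s]
      apply Finset.card_le_card
      intro t ht
      obtain ⟨-, a, ha, rfl⟩ := Finset.mem_filter.1 ht
      simpa using (h a ha [] s (.terminal s) (by simp [solutions])).symm
    simpa [attrs, depth] using h1
  | working f k lab child ih =>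
    let Xb : Bool → Set U.A := fun b => {a ∈ X | f.1 a = b}
    let C : Fin (k + 1) → Finset ℕ+ := fun i => V.filter fun t =>
      ∃ a ∈ Xb (lab i), val a = t ∧ ∃ e s, (child i).IsPath e s ∧ a ∈ U.solutions e
    let T : Bool → Finset ℕ+ := fun b => V.filter fun t => ∃ a ∈ Xb b, val a = t
    -- Here `C i` collects the values reached through child `i`, and `T b` all values present on
    -- side `b`. A good child is one for which the second alternative holds.
    let good : Fin (k + 1) → Prop := fun i =>
      (T (lab i)).card ≤ (child i).attrs.card + 1 ∧ (T (lab i)).card ≤ 2 ^ (child i).depth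
    have ih' : ∀ i, (C i).card ≤ (child i).attrs.card ∨ good i := by
      intro i
      refine ih i (X := Xb (lab i)) fun a ha e s hp hs => ?_
      refine h a ha.1 ((f, lab i) :: e) s (.working _ _ _ _ _ _ _ hp) fun p hp => ?_
      rcases List.mem_cons.1 hp with rfl | hp
      · exact ha.2
      · exact hs p hp
    let w : Bool → ℕ := fun b => ∑ i with lab i = b, (child i).attrs.card
    have hw : (working f k lab child).attrs.card = w false + w true + 1 := by
      have := Finset.sum_filter_add_sum_filter_not Finset.univ (fun i => lab i = false)
        fun i => (child i).attrs.card
      simp only [Bool.not_eq_false] at this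
      simp [attrs, w, this]
    have hle : ∀ i, (child i).attrs.card ≤ w (lab i) := fun i =>
      Finset.single_le_sum (f := fun i => (child i).attrs.card) (fun _ _ => Nat.zero_le _)
        (by simp)
    let D : Bool → Finset ℕ+ := fun b => (Finset.univ.filter fun i => lab i = b).biUnion C
    have hbad : ∀ b, (∀ i, lab i = b → ¬ good i) → (D b).card ≤ w b := by
      intro b hb
      refine Finset.card_biUnion_le.trans (Finset.sum_le_sum fun i hi => ?_)
      exact (ih' i).resolve_right (hb i (Finset.mem_filter.1 hi).2)
    have hDT : ∀ b, D b ⊆ T b := by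
      intro b t ht
      obtain ⟨i, hi, ht⟩ := Finset.mem_biUnion.1 ht
      obtain ⟨htV, a, ha, hat, -⟩ := Finset.mem_filter.1 ht
      rw [(Finset.mem_filter.1 hi).2] at ha
      exact Finset.mem_filter.2 ⟨htV, a, ha, hat⟩
    have hany : ∀ b, (D b).card ≤ w b + 1 := by
      intro b
      by_cases hb : ∀ i, lab i = b → ¬ good i
      · exact (hbad b hb).trans (Nat.le_succ _)
      · push Not at hb
        obtain ⟨i, rfl, hi⟩ := hb
        have := Finset.card_le_card (hDT (lab i))
        have := hle i
        have := hi.1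
        omega
    -- With a good child on each side, `(w false + 1) + (w true + 1)` is exactly one more than the
    -- number of working nodes, and the two powers of two add up to at most the next one.
    by_cases hg : ∀ b, ∃ i, lab i = b ∧ good i
    · right
      obtain ⟨i, hi, gi⟩ := hg false
      obtain ⟨j, hj, gj⟩ := hg true
      have hu : (V.filter fun t => ∃ a ∈ X, val a = t) ⊆ T false ∪ T true := by
        intro t ht
        obtain ⟨htV, a, ha, hat⟩ := Finset.mem_filter.1 ht
        cases hfa : f.1 a
        · exact Finset.mem_union_left _ (Finset.mem_filter.2 ⟨htV, a, ⟨ha, hfa⟩, hat⟩)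
        · exact Finset.mem_union_right _ (Finset.mem_filter.2 ⟨htV, a, ⟨ha, hfa⟩, hat⟩)
      have hu' := (Finset.card_le_card hu).trans (Finset.card_union_le _ _)
      have hli := hle i
      have hlj := hle j
      simp only [good, hi, hj] at gi gj hli hlj
      constructor
      · omega
      · have hpow : ∀ i, 2 ^ (child i).depth ≤ 2 ^ (Finset.univ.sup fun i => (child i).depth) :=
          fun i => Nat.pow_le_pow_right (by norm_num)
            (Finset.le_sup (f := fun i => (child i).depth) (Finset.mem_univ i))
        have h1 := hpow i
        have h2 := hpow j
        simp only [depth, pow_add, pow_one]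
        omega
    · left
      push Not at hg
      -- The side without a good child covers at most `w b` values. The other side may exceed its
      -- working nodes by one, which the node being queried pays for.
      obtain ⟨b, hb⟩ := hg
      have hcov : (V.filter fun t => ∃ a ∈ X, val a = t ∧ ∃ e s,
          (working f k lab child).IsPath e s ∧ a ∈ U.solutions e) ⊆ D b ∪ D (!b) := by
        intro t ht
        obtain ⟨htV, a, ha, hat, e, s, hp, hs⟩ := Finset.mem_filter.1 ht
        obtain ⟨i, e, hp', rfl⟩ := isPath_working.1 hp
        have hia : f.1 a = lab i := hs (f, lab i) (List.mem_cons_self ..)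
        have hC : t ∈ C i := Finset.mem_filter.2 ⟨htV, a, ⟨ha, hia⟩, hat, e, s, hp',
          fun p hp => hs p (List.mem_cons_of_mem _ hp)⟩
        have hD : t ∈ D (lab i) := Finset.mem_biUnion.2 ⟨i, by simp, hC⟩
        by_cases hib : lab i = b
        · exact Finset.mem_union_left _ (hib ▸ hD)
        · have : lab i = !b := by
            cases b <;> cases h : lab i <;> simp_all
          exact Finset.mem_union_right _ (this ▸ hD)
      have h1 := (Finset.card_le_card hcov).trans (Finset.card_union_le _ _)
      have h2 := hbad b hb
      have h3 := hany (!b)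
      rw [hw]
      cases b <;> simp only [Bool.not_false, Bool.not_true] at * <;> omega

end Node

variable {U : InfoSystem.{u}}

/-! ### Whole trees: lower bounds by the number of values -/

namespace DTree

/-- The decision tree with a single edge leaving the root. -/
def single (v : Node U) : DTree U := ⟨0, fun _ => v⟩

theorem size_single (v : Node U) : (single v).size = 1 + v.size := by
  change 1 + ∑ _i : Fin 1, v.size = _
  simp

theorem depth_single (v : Node U) : (single v).depth = v.depth := by
  change (Finset.univ : Finset (Fin 1)).sup (fun _ => v.depth) = _
  simp

theorem solvesD_single {v : Node U} {z : U.Problem} (hd : v.Deterministic)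
    (hc : v.Computes Set.univ z.value) : (single v).SolvesD z := by
  refine ⟨⟨rfl, fun _ => hd⟩, fun a => ?_, fun a e s hp hs => ?_⟩
  · obtain ⟨e, s, hp, hs⟩ := (hc a trivial).1
    exact ⟨e, s, ⟨0, hp⟩, hs⟩
  · exact (hc a trivial).2 e s hp.choose_spec hs

theorem SolvesD.exists_node {Γ : DTree U} {z : U.Problem} (h : Γ.SolvesD z) :
    ∃ v : Node U, v.Deterministic ∧ v.Computes Set.univ z.value ∧ Γ.size = 1 + v.size ∧
      Γ.depth = v.depth := by
  obtain ⟨k, child⟩ := Γ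
  obtain ⟨⟨hk, hd⟩, h1, h2⟩ := h
  obtain rfl : k = 0 := hk
  refine ⟨child 0, hd 0, fun a _ => ⟨?_, fun e s hp hs => h2 a e s ⟨0, hp⟩ hs⟩, ?_, ?_⟩
  · obtain ⟨e, s, ⟨i, hp⟩, hs⟩ := h1 a
    obtain rfl : i = 0 := Subsingleton.elim (α := Fin 1) _ _
    exact ⟨e, s, hp, hs⟩
  · simp [size]
  · simp [depth]

theorem SolvesD.size_le {Γ : DTree U} {z : U.Problem} (h : Γ.SolvesD z) :
    Γ.size ≤ 2 ^ (Γ.depth + 1) := by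
  obtain ⟨v, hv, -, hs, hd⟩ := h.exists_node
  have := hv.size_lt
  rw [hs, hd]
  omega

/-- A tree solving a problem has at least twice as many nodes as the problem has values, and more
if it is shallow. -/
theorem SolvesA.card_values_le {Γ : DTree U} {z : U.Problem} (h : Γ.SolvesA z) {V : Finset ℕ+}
    (hV : ∀ t ∈ V, ∃ a, z.value a = t) :
    2 * V.card ≤ Γ.size ∧ (V.card ≤ 2 ^ Γ.depth ∨ 2 * V.card + 1 ≤ Γ.size) := by
  classical
  have hsize : Γ.size = 1 + ∑ i, (Γ.child i).attrs.card + ∑ i, (Γ.child i).paths.card := by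
    simp only [size, Node.size_eq, Finset.sum_add_distrib]
    ring
  have hpaths : V.card ≤ ∑ i, (Γ.child i).paths.card := by
    have : V ⊆ ((∑ i, (Γ.child i).paths).map Prod.snd).toFinset := by
      intro t ht
      obtain ⟨a, rfl⟩ := hV t ht
      obtain ⟨e, s, ⟨i, hp⟩, hs⟩ := h.1 a
      obtain rfl := h.2 a e s ⟨i, hp⟩ hs
      simp only [Multiset.mem_toFinset, Multiset.mem_map, Multiset.mem_sum]
      exact ⟨_, ⟨i, Finset.mem_univ i, Node.mem_paths.2 hp⟩, rfl⟩
    refine (Finset.card_le_card this).trans ((Multiset.toFinset_card_le _).trans ?_)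
    rw [Multiset.card_map, Multiset.card_sum]
  have key := fun i => Node.card_values_le (v := Γ.child i) (X := Set.univ) (val := z.value)
    (fun a _ e s hp hs => h.2 a e s ⟨i, hp⟩ hs) V
  have hVf : (V.filter fun t => ∃ a ∈ Set.univ, z.value a = t) = V := by
    refine Finset.filter_true_of_mem fun t ht => ?_
    obtain ⟨a, ha⟩ := hV t ht
    exact ⟨a, trivial, ha⟩
  rw [hVf] at key
  -- There are at least `V.card` terminal nodes. A good child forces at least `V.card - 1` working
  -- nodes, its absence at least `V.card`; adding the root gives the two totals.
  by_cases hg : ∃ i, V.card ≤ (Γ.child i).attrs.card + 1 ∧ V.card ≤ 2 ^ (Γ.child i).depth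
  · obtain ⟨i, h1, h2⟩ := hg
    have h3 := Finset.single_le_sum (f := fun i => (Γ.child i).attrs.card)
      (fun _ _ => Nat.zero_le _) (Finset.mem_univ i)
    have h4 : (Γ.child i).depth ≤ Γ.depth :=
      Finset.le_sup (f := fun i => (Γ.child i).depth) (Finset.mem_univ i)
    have h5 := h2.trans (Nat.pow_le_pow_right (by norm_num) h4)
    exact ⟨by omega, .inl h5⟩
  · push Not at hg
    have h1 : V.card ≤ ∑ i, (Γ.child i).attrs.card := by
      have hsub : V ⊆ Finset.univ.biUnion fun i => V.filter fun t => ∃ a ∈ Set.univ,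
          z.value a = t ∧ ∃ e s, (Γ.child i).IsPath e s ∧ a ∈ U.solutions e := by
        intro t ht
        obtain ⟨a, hat⟩ := hV t ht
        obtain ⟨e, s, ⟨i, hp⟩, hs⟩ := h.1 a
        exact Finset.mem_biUnion.2 ⟨i, Finset.mem_univ i,
          Finset.mem_filter.2 ⟨ht, a, trivial, hat, e, s, hp, hs⟩⟩
      refine (Finset.card_le_card hsub).trans (Finset.card_biUnion_le.trans ?_)
      exact Finset.sum_le_sum fun i _ => (key i).resolve_right fun hi => (hg i hi.1).not_ge hi.2
    omega

/-- The alternative with more than `2 * V.card` nodes also bounds the depth, because a deterministic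
tree has at most $2^{h+1}$ nodes. -/
theorem SolvesD.card_values_le {Γ : DTree U} {z : U.Problem} (h : Γ.SolvesD z) {V : Finset ℕ+}
    (hV : ∀ t ∈ V, ∃ a, z.value a = t) : V.card ≤ 2 ^ Γ.depth := by
  rcases (h.2.card_values_le hV).2 with h1 | h1
  · exact h1
  · have := h.size_le
    rw [pow_succ] at this
    omega

end DTree

/-! ### Querying all attributes: upper bounds by the number of realized tuples -/

/-- The tuples of values of `f₁, …, fₙ` at the objects. -/
def patterns {n : ℕ} (f : Fin n → U.F) : Set (Fin n → Bool) := Set.range fun a i => (f i).1 a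

/-- An attribute constant on the current set is skipped, so every query splits the realized tuples
into two nonempty parts. A binary tree with $N$ terminal nodes has $2N-1$ nodes. -/
theorem Node.exists_of_list (fs : List U.F) {X : Set U.A} (hX : X.Nonempty) {val : U.A → ℕ+}
    (hval : ∀ a ∈ X, ∀ b ∈ X, (∀ f ∈ fs, f.1 a = f.1 b) → val a = val b) :
    ∃ v : Node U, v.Deterministic ∧ v.Computes X val ∧ v.depth ≤ fs.length ∧
      v.size + 1 ≤ 2 * ((fun a => fs.map fun f => f.1 a) '' X).ncard := by
  induction fs generalizing X with
  | nil =>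
    obtain ⟨a, ha⟩ := hX
    refine ⟨.terminal (val a), trivial,
      Node.computes_terminal fun b hb => hval b hb a ha (by simp), by simp [Node.depth], ?_⟩
    have : ((fun a => ([] : List U.F).map fun f => f.1 a) '' X) = {[]} := by
      simpa using Set.Nonempty.image_const ⟨a, ha⟩ ([] : List Bool)
    rw [this, Set.ncard_singleton]
    simp [Node.size]
  | cons f fs ih =>
    let Y : Bool → Set U.A := fun b => {a ∈ X | f.1 a = b}
    let I : Set U.A → Set (List Bool) := fun X => (fun a => fs.map fun f => f.1 a) '' X
    have hfin : ∀ Z, (I Z).Finite := by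
      intro Z
      refine (List.finite_length_eq Bool fs.length).subset ?_
      rintro _ ⟨a, -, rfl⟩
      simp
    have himage : ∀ b, (fun a => (f :: fs).map fun f => f.1 a) '' Y b = List.cons b '' I (Y b) := by
      intro b
      rw [Set.image_image]
      refine Set.image_congr fun a ha => ?_
      simp [ha.2]
    have hcard : ∀ b, ((fun a => (f :: fs).map fun f => f.1 a) '' Y b).ncard = (I (Y b)).ncard := by
      intro b
      rw [himage, Set.ncard_image_of_injective _ List.cons_injective]
    have hYval : ∀ b, ∀ a ∈ Y b, ∀ a' ∈ Y b, (∀ f ∈ fs, f.1 a = f.1 a') → val a = val a' := by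
      intro b a ha a' ha' h
      refine hval a ha.1 a' ha'.1 fun g hg => ?_
      rcases List.mem_cons.1 hg with rfl | hg
      · rw [ha.2, ha'.2]
      · exact h g hg
    by_cases hb : ∃ b, Y b = ∅
    · obtain ⟨b, hb⟩ := hb
      have hYX : Y (!b) = X := by
        refine Set.Subset.antisymm (fun a ha => ha.1) fun a ha => ⟨ha, ?_⟩
        by_contra hne
        have : a ∈ Y b := ⟨ha, by cases b <;> simp_all⟩
        simp [hb] at this
      obtain ⟨v, h1, h2, h3, h4⟩ := ih hX (hYX ▸ hYval (!b))
      refine ⟨v, h1, h2, h3.trans (by simp), h4.trans_eq ?_⟩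
      have := hcard (!b)
      rw [hYX] at this
      rw [this]
    · push Not at hb
      choose v h1 h2 h3 h4 using fun b => ih (hb b) (hYval b)
      refine ⟨.query f v, Node.deterministic_query h1, Node.computes_query h2, ?_, ?_⟩
      · rw [Node.depth_query, List.length_cons, add_comm]
        exact Nat.succ_le_succ (max_le (h3 _) (h3 _))
      · have hX : X = Y false ∪ Y true := by
          ext a
          cases h : f.1 a <;> simp [Y, h]
        have hdisj : Disjoint ((fun a => (f :: fs).map fun f => f.1 a) '' Y false)
            ((fun a => (f :: fs).map fun f => f.1 a) '' Y true) := by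
          rw [himage, himage, Set.disjoint_left]
          rintro _ ⟨l, -, rfl⟩ ⟨l', -, h⟩
          simp at h
        rw [hX, Set.image_union, Set.ncard_union_eq hdisj
          (by rw [himage]; exact (hfin _).image _) (by rw [himage]; exact (hfin _).image _),
          hcard, hcard, Node.size_query]
        have h5 := h4 false
        have h6 := h4 true
        simp only [I]
        omega

theorem Problem.exists_solvesD (z : U.Problem) :
    ∃ Γ : DTree U, Γ.SolvesD z ∧ Γ.depth ≤ z.dim ∧ Γ.size ≤ 2 * (patterns z.f).ncard := by
  have := U.infinite_objects
  obtain ⟨v, h1, h2, h3, h4⟩ := Node.exists_of_list (List.ofFn z.f) (X := Set.univ)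
    Set.univ_nonempty (val := z.value) (fun a _ b _ h => by
      unfold Problem.value
      congr 1
      funext i
      exact h _ (List.mem_ofFn.2 ⟨i, rfl⟩))
  refine ⟨.single v, DTree.solvesD_single h1 h2, ?_, ?_⟩
  · rw [DTree.depth_single]
    simpa using h3
  · rw [DTree.size_single, add_comm]
    refine h4.trans_eq ?_
    rw [← Set.ncard_image_of_injective (patterns z.f) List.ofFn_injective, patterns,
      Set.image_univ, ← Set.range_comp]
    congr 3
    funext a
    simp [List.map_ofFn, Function.comp_def]

theorem ncard_patterns_le {n : ℕ} (f : Fin n → U.F) : (patterns f).ncard ≤ 2 ^ n := by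
  refine (Set.ncard_le_card _).trans ?_
  simp

/-! ### Minima over trees and maxima over problems -/

theorem exists_hdProblem (z : U.Problem) : ∃ Γ : DTree U, Γ.SolvesD z ∧ Γ.depth = U.hdProblem z := by
  obtain ⟨Γ, h, -⟩ := z.exists_solvesD
  exact Nat.sInf_mem (s := {m | ∃ Γ : DTree U, Γ.SolvesD z ∧ Γ.depth = m}) ⟨_, Γ, h, rfl⟩

theorem exists_LdProblem (z : U.Problem) : ∃ Γ : DTree U, Γ.SolvesD z ∧ Γ.size = U.LdProblem z := by
  obtain ⟨Γ, h, -⟩ := z.exists_solvesD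
  exact Nat.sInf_mem (s := {m | ∃ Γ : DTree U, Γ.SolvesD z ∧ Γ.size = m}) ⟨_, Γ, h, rfl⟩

theorem exists_LaProblem (z : U.Problem) : ∃ Γ : DTree U, Γ.SolvesA z ∧ Γ.size = U.LaProblem z := by
  obtain ⟨Γ, h, -⟩ := z.exists_solvesD
  exact Nat.sInf_mem (s := {m | ∃ Γ : DTree U, Γ.SolvesA z ∧ Γ.size = m}) ⟨_, Γ, h.2, rfl⟩

theorem DTree.SolvesD.hdProblem_le {Γ : DTree U} {z : U.Problem} (h : Γ.SolvesD z) :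
    U.hdProblem z ≤ Γ.depth := Nat.sInf_le ⟨Γ, h, rfl⟩

theorem DTree.SolvesD.LdProblem_le {Γ : DTree U} {z : U.Problem} (h : Γ.SolvesD z) :
    U.LdProblem z ≤ Γ.size := Nat.sInf_le ⟨Γ, h, rfl⟩

theorem DTree.SolvesA.haProblem_le {Γ : DTree U} {z : U.Problem} (h : Γ.SolvesA z) :
    U.haProblem z ≤ Γ.depth := Nat.sInf_le ⟨Γ, h, rfl⟩

theorem DTree.SolvesA.LaProblem_le {Γ : DTree U} {z : U.Problem} (h : Γ.SolvesA z) :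
    U.LaProblem z ≤ Γ.size := Nat.sInf_le ⟨Γ, h, rfl⟩

theorem LdProblem_le_patterns (z : U.Problem) : U.LdProblem z ≤ 2 * (patterns z.f).ncard := by
  obtain ⟨Γ, h, -, hs⟩ := z.exists_solvesD
  exact h.LdProblem_le.trans hs

theorem LaProblem_le_patterns (z : U.Problem) : U.LaProblem z ≤ 2 * (patterns z.f).ncard := by
  obtain ⟨Γ, h, -, hs⟩ := z.exists_solvesD
  exact h.2.LaProblem_le.trans hs

/-- A complexity measure of problems bounded in terms of the dimension has a maximum over the problems
of dimension at most `n`. -/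
theorem bddAbove_of_le (μ : U.Problem → ℕ) (g : ℕ → ℕ) (hg : Monotone g)
    (h : ∀ z, μ z ≤ g z.dim) (n : ℕ) : BddAbove {m | ∃ z : U.Problem, z.dim ≤ n ∧ μ z = m} := by
  refine ⟨g n, ?_⟩
  rintro _ ⟨z, hz, rfl⟩
  exact (h z).trans (hg hz)

theorem hdProblem_le_hd (z : U.Problem) {n : ℕ} (h : z.dim ≤ n) : U.hdProblem z ≤ U.hd n := by
  refine le_csSup (bddAbove_of_le U.hdProblem id monotone_id (fun z => ?_) n) ⟨z, h, rfl⟩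
  obtain ⟨Γ, h, hd, -⟩ := z.exists_solvesD
  exact h.hdProblem_le.trans hd

theorem monotone_two_mul_two_pow : Monotone fun n : ℕ => 2 * 2 ^ n := fun _ _ h =>
  Nat.mul_le_mul_left _ (Nat.pow_le_pow_right (by norm_num) h)

theorem bddAbove_Ld (n : ℕ) : BddAbove {m | ∃ z : U.Problem, z.dim ≤ n ∧ U.LdProblem z = m} :=
  bddAbove_of_le U.LdProblem _ monotone_two_mul_two_pow
    (fun z => (LdProblem_le_patterns z).trans (Nat.mul_le_mul_left _ (ncard_patterns_le z.f))) n

theorem bddAbove_La (n : ℕ) : BddAbove {m | ∃ z : U.Problem, z.dim ≤ n ∧ U.LaProblem z = m} :=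
  bddAbove_of_le U.LaProblem _ monotone_two_mul_two_pow
    (fun z => (LaProblem_le_patterns z).trans (Nat.mul_le_mul_left _ (ncard_patterns_le z.f))) n

theorem LdProblem_le_Ld (z : U.Problem) {n : ℕ} (h : z.dim ≤ n) : U.LdProblem z ≤ U.Ld n :=
  le_csSup (bddAbove_Ld n) ⟨z, h, rfl⟩

theorem LaProblem_le_La (z : U.Problem) {n : ℕ} (h : z.dim ≤ n) : U.LaProblem z ≤ U.La n :=
  le_csSup (bddAbove_La n) ⟨z, h, rfl⟩

theorem exists_problem (U : InfoSystem.{u}) {n : ℕ} (hn : 1 ≤ n) : ∃ z : U.Problem, z.dim ≤ n := by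
  obtain ⟨f, hf⟩ := U.infinite_attributes.nonempty
  exact ⟨⟨1, one_pos, fun _ => 1, fun _ => ⟨f, hf⟩⟩, hn⟩

theorem sSup_problems_le {n : ℕ} (hn : 1 ≤ n) {μ : U.Problem → ℕ} {B : ℕ}
    (h : ∀ z : U.Problem, z.dim ≤ n → μ z ≤ B) :
    sSup {m | ∃ z : U.Problem, z.dim ≤ n ∧ μ z = m} ≤ B := by
  obtain ⟨z, hz⟩ := U.exists_problem hn
  refine csSup_le ⟨_, z, hz, rfl⟩ ?_
  rintro _ ⟨z, hz, rfl⟩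
  exact h z hz

theorem exists_LaProblem_eq_La (U : InfoSystem.{u}) {n : ℕ} (hn : 1 ≤ n) :
    ∃ z : U.Problem, z.dim ≤ n ∧ U.LaProblem z = U.La n := by
  obtain ⟨z, hz⟩ := U.exists_problem hn
  exact Nat.sSup_mem (s := {m | ∃ z : U.Problem, z.dim ≤ n ∧ U.LaProblem z = m})
    ⟨_, z, hz, rfl⟩ (bddAbove_La n)

theorem La_mono (U : InfoSystem.{u}) {m n : ℕ} (hm : 1 ≤ m) (h : m ≤ n) : U.La m ≤ U.La n := by
  obtain ⟨z, hz, hz'⟩ := U.exists_LaProblem_eq_La hm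
  exact hz' ▸ LaProblem_le_La z (hz.trans h)

/-! ### Identification problems and failure of $a$-reachability -/

/-- The problem of recognizing the values of all the attributes `f₁, …, fₙ`. -/
def identify {n : ℕ} (hn : 0 < n) (f : Fin n → U.F) : U.Problem where
  dim := n
  dim_pos := hn
  ν b := Nat.succPNat (Encodable.encode b)
  f := f

theorem identify_value_inj {n : ℕ} {hn : 0 < n} {f : Fin n → U.F} {a b : U.A}
    (h : (identify hn f).value a = (identify hn f).value b) (i : Fin n) :
    (f i).1 a = (f i).1 b :=
  congrFun (Encodable.encode_injective (Nat.succPNat_injective h)) i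

theorem exists_values_identify {n : ℕ} (hn : 0 < n) (f : Fin n → U.F) :
    ∃ V : Finset ℕ+, V.card = (patterns f).ncard ∧ ∀ t ∈ V, ∃ a, (identify hn f).value a = t := by
  classical
  refine ⟨(Set.toFinite (patterns f)).toFinset.image (Nat.succPNat ∘ Encodable.encode),
    ?_, ?_⟩
  · rw [Finset.card_image_of_injective _
      (Nat.succPNat_injective.comp Encodable.encode_injective), Set.ncard_eq_toFinset_card]
  · intro t ht
    obtain ⟨b, hb, rfl⟩ := Finset.mem_image.1 ht
    obtain ⟨a, rfl⟩ := (Set.Finite.mem_toFinset _).1 hb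
    exact ⟨a, rfl⟩

/-- Take $n=2^c$, a problem attaining $L^a(n)$, and the identification of its $N$ tuples. From
$2(2^c+1)\le L^a(n)\le 2N$ follows $N>2^c$. A tree with at most $L^a(n)\le 2N$ nodes has $N\le
2^{h}$, so its depth exceeds $c$. -/
theorem not_AReachable {c : ℕ} (hc : ∀ n, 1 ≤ n → U.ha n ≤ c)
    (hL : ∀ n, 1 ≤ n → 2 * (n + 1) ≤ U.La n) : ¬ U.AReachable := by
  intro h
  have hn : 1 ≤ 2 ^ c := Nat.one_le_two_pow
  obtain ⟨z, hz, hzL⟩ := U.exists_LaProblem_eq_La hn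
  obtain ⟨Γ, hΓ, hd, hs⟩ := h (identify z.dim_pos z.f)
  obtain ⟨V, hV, hV'⟩ := exists_values_identify z.dim_pos z.f
  have hd' : Γ.depth ≤ c := (Nat.cast_le.1 hd).trans (hc _ z.dim_pos)
  have hs' : Γ.size ≤ U.La (2 ^ c) := (Nat.cast_le.1 hs).trans (U.La_mono z.dim_pos hz)
  have h1 := LaProblem_le_patterns z
  have h2 := hL _ hn
  have h3 : 2 ^ Γ.depth ≤ 2 ^ c := Nat.pow_le_pow_right (by norm_num) hd'
  rcases (hΓ.card_values_le hV').2 with h4 | h4 <;> omega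

/-! ### Shortening systems of equations and shallow nondeterministic trees -/

/-- A solution set is a union of few solution sets of systems given by the paths of a
deterministic tree. -/
theorem exists_cover (e : List (U.F × Bool)) (he : e ≠ []) :
    ∃ P : Multiset (List (U.F × Bool)), P.card ≤ 2 ^ U.hd e.length ∧
      (∀ e' ∈ P, e'.length ≤ U.hd e.length) ∧
      ∀ a, a ∈ U.solutions e ↔ ∃ e' ∈ P, a ∈ U.solutions e' := by
  classical
  -- The value 1 marks the objects satisfying every equation of `e`, so the paths ending in 1 form
  -- the cover.
  let z : U.Problem :=
    { dim := e.length
      dim_pos := List.length_pos_of_ne_nil he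
      ν := fun b => if ∀ i, b i = (e.get i).2 then 1 else 2
      f := fun i => (e.get i).1 }
  have hz : ∀ a, z.value a = 1 ↔ a ∈ U.solutions e := by
    intro a
    have h1 : a ∈ U.solutions e ↔ ∀ i, (e.get i).1.1 a = (e.get i).2 := by
      constructor
      · exact fun h i => h _ (List.get_mem e i)
      · intro h p hp
        obtain ⟨i, rfl⟩ := List.get_of_mem hp
        exact h i
    rw [h1]
    change (if ∀ i, (e.get i).1.1 a = (e.get i).2 then (1 : ℕ+) else 2) = 1 ↔ _
    split_ifs with h
    · simpa using h
    · simpa using h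
  obtain ⟨Γ, hΓ, hd⟩ := exists_hdProblem z
  obtain ⟨v, hv, hc, -, hvd⟩ := hΓ.exists_node
  have hd' : v.depth ≤ U.hd e.length := by
    rw [← hvd, hd]
    exact hdProblem_le_hd z le_rfl
  refine ⟨(v.paths.filter fun p => p.2 = 1).map Prod.fst, ?_, ?_, fun a => ?_⟩
  · rw [Multiset.card_map]
    exact (Multiset.card_le_card (Multiset.filter_le _ _)).trans
      (hv.card_paths_le.trans (Nat.pow_le_pow_right (by norm_num) hd'))
  · intro e' he'
    obtain ⟨⟨e'', s⟩, hp, rfl⟩ := Multiset.mem_map.1 he'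
    exact (Node.mem_paths.1 (Multiset.mem_filter.1 hp).1).length_le_depth.trans hd'
  · rw [← hz]
    constructor
    · intro h
      obtain ⟨⟨e', s, hp, hs⟩, hu⟩ := hc a trivial
      have hs1 := hu e' s hp hs
      rw [h] at hs1
      exact ⟨e', Multiset.mem_map.2 ⟨(e', s), Multiset.mem_filter.2
        ⟨Node.mem_paths.2 hp, hs1⟩, rfl⟩, hs⟩
    · rintro ⟨e', he', hs⟩
      obtain ⟨⟨e', s⟩, hp, rfl⟩ := Multiset.mem_map.1 he'
      obtain ⟨hp, rfl⟩ := Multiset.mem_filter.1 hp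
      exact ((hc a trivial).2 e' 1 (Node.mem_paths.1 hp) hs).symm

/-- Iterated covering: systems of bounded length suffice. -/
theorem exists_short_cover {M : ℕ} (hM : ∀ m, M < m → 2 * U.hd m ≤ m) (e : List (U.F × Bool)) :
    ∃ P : Multiset (List (U.F × Bool)), P.card ≤ 2 ^ (2 * e.length) ∧
      (∀ e' ∈ P, e'.length ≤ M) ∧ ∀ a, a ∈ U.solutions e ↔ ∃ e' ∈ P, a ∈ U.solutions e' := by
  induction hm : e.length using Nat.strong_induction_on generalizing e with
  | _ m ih =>
    by_cases hle : m ≤ M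
    · exact ⟨{e}, by simpa using Nat.one_le_two_pow, by simpa [hm] using hle, by simp⟩
    · push Not at hle
      have hh := hM m hle
      obtain ⟨P, hP1, hP2, hP3⟩ := exists_cover e (by rintro rfl; simp at hm; omega)
      rw [hm] at hP1 hP2
      have key : ∀ e' : List (U.F × Bool), ∃ Q : Multiset (List (U.F × Bool)), e' ∈ P →
          Q.card ≤ 2 ^ (2 * U.hd m) ∧ (∀ e'' ∈ Q, e''.length ≤ M) ∧
          ∀ a, a ∈ U.solutions e' ↔ ∃ e'' ∈ Q, a ∈ U.solutions e'' := by
        intro e'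
        by_cases he' : e' ∈ P
        · have hl := hP2 e' he'
          obtain ⟨Q, h1, h2⟩ := ih e'.length (by omega) e' rfl
          exact ⟨Q, fun _ => ⟨h1.trans (Nat.pow_le_pow_right (by norm_num) (by omega)), h2⟩⟩
        · exact ⟨0, fun h => absurd h he'⟩
      choose Q hQ using key
      refine ⟨P.bind Q, ?_, ?_, fun a => ?_⟩
      · rw [Multiset.card_bind]
        calc (P.map (Multiset.card ∘ Q)).sum
            ≤ (P.map (Multiset.card ∘ Q)).card • 2 ^ (2 * U.hd m) := by
              refine Multiset.sum_le_card_nsmul _ _ fun x hx => ?_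
              obtain ⟨e', he', rfl⟩ := Multiset.mem_map.1 hx
              exact (hQ e' he').1
          _ ≤ 2 ^ U.hd m * 2 ^ (2 * U.hd m) := by
              rw [Multiset.card_map, smul_eq_mul]
              exact Nat.mul_le_mul_right _ hP1
          -- The exponent `3 * U.hd m` is at most `3m/2`, so the bound $2^{2m}$ reproduces itself
          -- under the recursion.
          _ ≤ 2 ^ (2 * m) := by
              rw [← pow_add]
              exact Nat.pow_le_pow_right (by norm_num) (by omega)
      · intro e'' he''
        obtain ⟨e', he', h⟩ := Multiset.mem_bind.1 he''
        exact (hQ e' he').2.1 e'' h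
      · rw [hP3]
        constructor
        · rintro ⟨e', he', h⟩
          obtain ⟨e'', h1, h2⟩ := ((hQ e' he').2.2 a).1 h
          exact ⟨e'', Multiset.mem_bind.2 ⟨e', he', h1⟩, h2⟩
        · rintro ⟨e'', he'', h⟩
          obtain ⟨e', he', h1⟩ := Multiset.mem_bind.1 he''
          exact ⟨e', he', ((hQ e' he').2.2 a).2 ⟨e'', h1, h⟩⟩

namespace Node

/-- The node with a single path, given by a system of equations and a label. -/
def chain : List (U.F × Bool) → ℕ+ → Node U
  | [], s => terminal s
  | p :: e, s => working p.1 0 (fun _ => p.2) fun _ => chain e s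

theorem size_chain (e : List (U.F × Bool)) (s : ℕ+) : (chain e s).size = e.length + 1 := by
  induction e with
  | nil => rfl
  | cons p e ih => simp [chain, size, ih, add_comm]

theorem depth_chain (e : List (U.F × Bool)) (s : ℕ+) : (chain e s).depth = e.length := by
  induction e with
  | nil => rfl
  | cons p e ih => simp [chain, depth, ih, add_comm]

theorem isPath_chain {e e' : List (U.F × Bool)} {s s' : ℕ+} :
    (chain e s).IsPath e' s' ↔ e' = e ∧ s' = s := by
  induction e generalizing e' with
  | nil => exact isPath_terminal
  | cons p e ih =>
    rw [chain, isPath_working]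
    simp only [ih]
    constructor
    · rintro ⟨-, e, ⟨rfl, rfl⟩, rfl⟩
      exact ⟨rfl, rfl⟩
    · rintro ⟨rfl, rfl⟩
      exact ⟨0, e, ⟨rfl, rfl⟩, rfl⟩

end Node

/-- A nondeterministic tree consisting of given paths. -/
theorem Problem.exists_solvesA_of_cover (z : U.Problem) (P : Multiset (List (U.F × Bool) × ℕ+))
    (hcov : ∀ a, ∃ p ∈ P, a ∈ U.solutions p.1)
    (hval : ∀ a, ∀ p ∈ P, a ∈ U.solutions p.1 → p.2 = z.value a)
    {M : ℕ} (hM : ∀ p ∈ P, p.1.length ≤ M) :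
    ∃ Γ : DTree U, Γ.SolvesA z ∧ Γ.depth ≤ M ∧ Γ.size ≤ 1 + P.card * (M + 1) := by
  have hmem : ∀ p, p ∈ P ↔ p ∈ P.toList := fun p => Multiset.mem_toList.symm
  have hcard : P.card = P.toList.length := (Multiset.length_toList P).symm
  have hne : P.toList ≠ [] := by
    have := U.infinite_objects
    obtain ⟨p, hp, -⟩ := hcov (Classical.arbitrary U.A)
    exact List.ne_nil_of_mem ((hmem p).1 hp)
  simp only [hmem] at hcov hval hM
  rw [hcard]
  generalize P.toList = l at *
  obtain ⟨p, l, rfl⟩ := List.exists_cons_of_ne_nil hne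
  let Γ : DTree U := ⟨l.length, fun i => .chain ((p :: l).get i).1 ((p :: l).get i).2⟩
  refine ⟨Γ, ⟨fun a => ?_, ?_⟩, ?_, ?_⟩
  · obtain ⟨q, hq, ha⟩ := hcov a
    obtain ⟨i, rfl⟩ := List.get_of_mem hq
    exact ⟨_, _, ⟨i, Node.isPath_chain.2 ⟨rfl, rfl⟩⟩, ha⟩
  · rintro a e s ⟨i, hp⟩ ha
    obtain ⟨rfl, rfl⟩ := Node.isPath_chain.1 hp
    exact hval a _ (List.get_mem (p :: l) i) ha
  · refine Finset.sup_le fun i _ => ?_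
    rw [Node.depth_chain]
    exact hM _ (List.get_mem (p :: l) i)
  · refine Nat.add_le_add_left ?_ 1
    calc ∑ i : Fin (l.length + 1), (Γ.child i).size ≤ ∑ _i : Fin (l.length + 1), (M + 1) := by
          refine Finset.sum_le_sum fun i _ => ?_
          change (Node.chain _ _).size ≤ _
          rw [Node.size_chain]
          exact Nat.succ_le_succ (hM _ (List.get_mem (p :: l) i))
      _ = _ := by simp

/-- A depth-optimal deterministic tree has at most $2^h$ paths of length at most $h$, with
$h=h^d(\dim z)$. Each is replaced by at most $2^{2h}$ chains of length at most $M$, hence the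
exponent $3h$. -/
theorem Problem.exists_shallow_solvesA {M : ℕ} (hM : ∀ m, M < m → 2 * U.hd m ≤ m)
    (z : U.Problem) :
    ∃ Γ : DTree U, Γ.SolvesA z ∧ Γ.depth ≤ M ∧ Γ.size ≤ (M + 2) * 2 ^ (3 * U.hd z.dim) := by
  obtain ⟨Γ, hΓ, hd⟩ := exists_hdProblem z
  obtain ⟨v, hv, hc, -, hvd⟩ := hΓ.exists_node
  have hd' : v.depth ≤ U.hd z.dim := by
    rw [← hvd, hd]
    exact hdProblem_le_hd z le_rfl
  choose Q hQ1 hQ2 hQ3 using fun e => exists_short_cover hM e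
  let P := v.paths.bind fun p => (Q p.1).map fun e => (e, p.2)
  have hP : P.card ≤ 2 ^ (3 * U.hd z.dim) := by
    rw [Multiset.card_bind]
    calc (v.paths.map _).sum
        ≤ (v.paths.map _).card • 2 ^ (2 * U.hd z.dim) := by
          refine Multiset.sum_le_card_nsmul _ _ fun x hx => ?_
          obtain ⟨⟨e, s⟩, hp, rfl⟩ := Multiset.mem_map.1 hx
          simp only [Function.comp_apply, Multiset.card_map]
          have := (Node.mem_paths.1 hp).length_le_depth
          exact (hQ1 e).trans (Nat.pow_le_pow_right (by norm_num) (by omega))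
      _ ≤ 2 ^ U.hd z.dim * 2 ^ (2 * U.hd z.dim) := by
          rw [Multiset.card_map, smul_eq_mul]
          exact Nat.mul_le_mul_right _
            (hv.card_paths_le.trans (Nat.pow_le_pow_right (by norm_num) hd'))
      _ = 2 ^ (3 * U.hd z.dim) := by
          rw [← pow_add]
          congr 1
          ring
  have hPmem : ∀ e s, (e, s) ∈ P ↔ ∃ e', v.IsPath e' s ∧ e ∈ Q e' := by
    intro e s
    simp only [P, Multiset.mem_bind, Multiset.mem_map, Prod.mk.injEq, Prod.exists]
    constructor
    · rintro ⟨e', s', hp, e'', h, rfl, rfl⟩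
      exact ⟨e', Node.mem_paths.1 hp, h⟩
    · rintro ⟨e', hp, h⟩
      exact ⟨e', s, Node.mem_paths.2 hp, e, h, rfl, rfl⟩
  obtain ⟨Γ, h1, h2, h3⟩ := z.exists_solvesA_of_cover P (M := M)
    (fun a => by
      obtain ⟨e, s, hp, hs⟩ := (hc a trivial).1
      obtain ⟨e', he', hs'⟩ := (hQ3 e a).1 hs
      exact ⟨(e', s), (hPmem _ _).2 ⟨e, hp, he'⟩, hs'⟩)
    (by
      rintro a ⟨e, s⟩ hp hs
      obtain ⟨e', hp', he⟩ := (hPmem _ _).1 hp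
      exact (hc a trivial).2 e' s hp' ((hQ3 e' a).2 ⟨e, he, hs⟩))
    (by
      rintro ⟨e, s⟩ hp
      obtain ⟨e', -, he⟩ := (hPmem _ _).1 hp
      exact hQ2 e' e he)
  refine ⟨Γ, h1, h2, h3.trans ?_⟩
  have h4 : 1 ≤ 2 ^ (3 * U.hd z.dim) := Nat.one_le_two_pow
  nlinarith

/-! ### Consequences of logarithmic deterministic depth -/

/-- The upper bound in the type of behavior LOG for one exponent makes `h` eventually sublinear. -/
theorem exists_sublinear {h : ℕ → ℕ} {c ε : ℝ} (hε : ε < 1) (hc : 0 < c)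
    (hb : ∀ n : ℕ, 1 ≤ n → (h n : ℝ) ≤ c * (Real.logb 2 n) ^ (1 + ε) + 1) :
    ∃ M : ℕ, ∀ m, M < m → 2 * h m ≤ m := by
  have h1 := (Real.isLittleO_pow_log_id_atTop (n := 2)).comp_tendsto tendsto_natCast_atTop_atTop
  -- This constant is chosen so that $c(\log_2 m)^2\le m/4$ eventually.
  have hK : 0 < Real.log 2 ^ 2 / (4 * c) := by
    have := Real.log_pos (by norm_num : (1 : ℝ) < 2)
    positivity
  obtain ⟨M, hM⟩ := Filter.eventually_atTop.1 (h1.bound hK)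
  -- Beyond 4 one has $2(m/4+1)\le m$, which absorbs the additive 1, and $\log_2 m\ge 1$, which
  -- allows raising the exponent to 2.
  refine ⟨max M 4, fun m hm => ?_⟩
  have hm4 : 4 < m := (le_max_right _ _).trans_lt hm
  have hmR : (4 : ℝ) < m := by exact_mod_cast hm4
  have hlog2 := Real.log_pos (by norm_num : (1 : ℝ) < 2)
  have h2 := hM m ((le_max_left _ _).trans hm.le)
  simp only [Function.comp_apply, id, Real.norm_eq_abs, abs_pow, sq_abs, Nat.abs_cast] at h2
  have h3 : (1 : ℝ) ≤ Real.logb 2 m := by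
    rw [Real.le_logb_iff_rpow_le (by norm_num) (by linarith)]
    norm_num
    linarith
  have h4 : (Real.logb 2 m) ^ (1 + ε) ≤ (Real.logb 2 m) ^ 2 := by
    rw [← Real.rpow_two]
    exact Real.rpow_le_rpow_of_exponent_le h3 (by linarith)
  have h5 : c * (Real.logb 2 m) ^ 2 ≤ m / 4 := by
    rw [Real.logb, div_pow, ← mul_div_assoc, div_le_iff₀ (by positivity)]
    calc c * Real.log m ^ 2 ≤ c * (Real.log 2 ^ 2 / (4 * c) * m) := by gcongr
      _ = _ := by field_simp
  have h6 := hb m (by omega)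
  have h7 : c * (Real.logb 2 m) ^ (1 + ε) ≤ c * (Real.logb 2 m) ^ 2 := by gcongr
  have h8 : (2 * h m : ℝ) ≤ m := by linarith
  exact_mod_cast h8

theorem IsLOG.exists_sublinear {h : ℕ → ℕ} (hh : IsLOG h) : ∃ M : ℕ, ∀ m, M < m → 2 * h m ≤ m := by
  obtain ⟨c, hc, hb⟩ := hh (1 / 2) (by norm_num) (by norm_num)
  exact InfoSystem.exists_sublinear (by norm_num) hc fun n hn => (hb n hn).2

theorem isCON_ha_of_isLOG_hd (h : IsLOG U.hd) : IsCON U.ha := by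
  obtain ⟨M, hM⟩ := h.exists_sublinear
  refine ⟨M + 1, by positivity, fun n hn => ?_⟩
  have : U.ha n ≤ M := sSup_problems_le hn fun z _ => by
    obtain ⟨Γ, h1, h2, -⟩ := z.exists_shallow_solvesA hM
    exact h1.haProblem_le.trans h2
  have : (U.ha n : ℝ) ≤ M := by exact_mod_cast this
  linarith

theorem IsLOG.exists_boundaryDPair (h : IsLOG U.hd) {ε : ℝ} (h0 : 0 < ε) (h1 : ε < 1) :
    ∃ c : ℝ, 0 < c ∧ U.IsBoundaryDPair (fun n => c * (Real.logb 2 n) ^ (1 + ε) + 1)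
      (fun n => (2 : ℝ) ^ (c * (Real.logb 2 n) ^ (1 + ε) + 2)) := by
  obtain ⟨c, hc, hb⟩ := h ε h0 h1
  refine ⟨c, hc, fun z => ?_⟩
  obtain ⟨Γ, hΓ, hd⟩ := exists_hdProblem z
  have hd' : (Γ.depth : ℝ) ≤ c * (Real.logb 2 z.dim) ^ (1 + ε) + 1 := by
    refine le_trans ?_ (hb z.dim z.dim_pos).2
    rw [hd]
    exact_mod_cast hdProblem_le_hd z le_rfl
  refine ⟨Γ, hΓ, hd', ?_⟩
  calc (Γ.size : ℝ) ≤ 2 ^ (Γ.depth + 1) := by exact_mod_cast hΓ.size_le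
    _ = (2 : ℝ) ^ ((Γ.depth : ℝ) + 1) := by rw [← Real.rpow_natCast]; push_cast; rfl
    _ ≤ _ := Real.rpow_le_rpow_of_exponent_le (by norm_num) (by linarith)

theorem IsLOG.exists_boundaryAPair (h : IsLOG U.hd) {ε : ℝ} (h0 : 0 < ε) (h1 : ε < 1) :
    ∃ c₁ c₂ c₃ : ℝ, 0 < c₁ ∧ 0 < c₂ ∧ 0 < c₃ ∧ U.IsBoundaryAPair (fun _ => c₁)
      (fun n => (2 : ℝ) ^ (c₂ * (Real.logb 2 n) ^ (1 + ε) + c₃)) := by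
  obtain ⟨c, hc, hb⟩ := h ε h0 h1
  obtain ⟨M, hM⟩ := h.exists_sublinear
  -- The depth is at most `M`; `M + 1` only secures positivity. The node bound uses $M+2\le 2^{M+2}$
  -- and three times $h^d(n)\le c(\log_2 n)^{1+\varepsilon}+1$, whose constant part is the final 3.
  refine ⟨M + 1, 3 * c, M + 2 + 3, by positivity, by positivity, by positivity, fun z => ?_⟩
  obtain ⟨Γ, hΓ, hd, hs⟩ := z.exists_shallow_solvesA hM
  have hd' : (Γ.depth : ℝ) ≤ M + 1 := by exact_mod_cast hd.trans (Nat.le_succ M)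
  refine ⟨Γ, hΓ, hd', ?_⟩
  have hz := (hb z.dim z.dim_pos).2
  have hs' : Γ.size ≤ 2 ^ ((M + 2) + 3 * U.hd z.dim) := by
    rw [pow_add]
    exact hs.trans (Nat.mul_le_mul_right _ (Nat.lt_two_pow_self).le)
  calc (Γ.size : ℝ) ≤ 2 ^ ((M + 2) + 3 * U.hd z.dim) := by exact_mod_cast hs'
    _ = (2 : ℝ) ^ ((M : ℝ) + 2 + 3 * U.hd z.dim) := by rw [← Real.rpow_natCast]; push_cast; rfl
    _ ≤ _ := Real.rpow_le_rpow_of_exponent_le (by norm_num) (by linarith)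

/-! ### Systems of independence dimension one -/

/-- No two different attributes are independent. -/
def PairDependent (U : InfoSystem.{u}) : Prop :=
  ∀ f ∈ U.F, ∀ g ∈ U.F, f ≠ g → ∃ δ ε, ∀ a, ¬ (f a = δ ∧ g a = ε)

/-- By the Sauer–Shelah argument in Pajor's form, a set family has at most as many members as it
shatters sets. Dependence of pairs leaves only the empty set and singletons to be shattered. -/
theorem PairDependent.ncard_patterns_le (h : U.PairDependent) {n : ℕ} (f : Fin n → U.F) :
    (patterns f).ncard ≤ n + 1 := by
  classical
  let S : (Fin n → Bool) → Finset (Fin n) := fun b => Finset.univ.filter fun i => b i = true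
  have hS : Function.Injective S := by
    intro b b' hb
    funext i
    have := Finset.ext_iff.1 hb i
    simp only [S, Finset.mem_filter, Finset.mem_univ, true_and] at this
    exact Bool.eq_iff_iff.2 this
  let 𝒜 : Finset (Finset (Fin n)) := (Set.toFinite (patterns f)).toFinset.image S
  have hcard : (patterns f).ncard = 𝒜.card := by
    rw [Finset.card_image_of_injective _ hS, Set.ncard_eq_toFinset_card]
  have hsub : 𝒜.shatterer ⊆ insert ∅ (Finset.univ.image fun i => {i}) := by
    intro s hs
    have hs1 : s.card ≤ 1 := by
      by_contra! hc
      obtain ⟨i, hi, j, hj, hij⟩ := Finset.one_lt_card.1 hc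
      have hdep : ∃ δ ε, ∀ a, ¬ ((f i).1 a = δ ∧ (f j).1 a = ε) := by
        -- Different indices may carry the same attribute, which cannot take two values at one
        -- object.
        by_cases hf : (f i).1 = (f j).1
        · exact ⟨true, false, fun a ⟨h1, h2⟩ => by simp [hf, h2] at h1⟩
        · exact h _ (f i).2 _ (f j).2 hf
      obtain ⟨δ, ε, hδ⟩ := hdep
      -- The subset to be cut out contains `i` iff `δ` is true and `j` iff `ε` is true, so an object
      -- cutting it out attains the excluded pair of values.
      obtain ⟨u, hu, hsu⟩ := (Finset.mem_shatterer.1 hs)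
        (Finset.filter_subset (fun k => (k = i → δ = true) ∧ (k = j → ε = true)) s)
      obtain ⟨b, hb, rfl⟩ := Finset.mem_image.1 hu
      obtain ⟨a, rfl⟩ := (Set.Finite.mem_toFinset _).1 hb
      have h1 := Finset.ext_iff.1 hsu i
      have h2 := Finset.ext_iff.1 hsu j
      simp only [S, Finset.mem_inter, Finset.mem_filter, Finset.mem_univ, true_and, hi, hj, hij,
        hij.symm, false_imp_iff, and_true, forall_const] at h1 h2
      exact hδ a ⟨Bool.eq_iff_iff.2 h1, Bool.eq_iff_iff.2 h2⟩
    rcases Nat.le_one_iff_eq_zero_or_eq_one.1 hs1 with h0 | h0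
    · simp [Finset.card_eq_zero.1 h0]
    · obtain ⟨i, rfl⟩ := Finset.card_eq_one.1 h0
      simp
  calc (patterns f).ncard = 𝒜.card := hcard
    _ ≤ 𝒜.shatterer.card := 𝒜.card_le_card_shatterer
    _ ≤ _ := Finset.card_le_card hsub
    _ ≤ _ := Finset.card_insert_le _ _
    _ ≤ n + 1 := by
      refine Nat.succ_le_succ (Finset.card_image_le.trans ?_)
      simp

theorem PairDependent.iDim_eq_one (h : U.PairDependent) {f : U.A → Bool} (hf : f ∈ U.F)
    (hb : ∀ b, ∃ a, f a = b) : U.iDim = 1 := by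
  classical
  refine le_antisymm (iSup₂_le fun S hS => ?_) ?_
  · have : S.card ≤ 1 := by
      by_contra! hc
      obtain ⟨f, hf, g, hg, hfg⟩ := Finset.one_lt_card.1 hc
      obtain ⟨δ, ε, hd⟩ := h f (hS.1 hf) g (hS.1 hg) hfg
      obtain ⟨a, ha⟩ := hS.2 fun k => if k = f then δ else ε
      refine hd a ⟨?_, ?_⟩
      · simpa using ha f hf
      · simpa [hfg.symm] using ha g hg
    exact_mod_cast this
  · refine le_iSup₂_of_le {f} ⟨by simpa using hf, fun δ => ?_⟩ (by simp)
    obtain ⟨a, ha⟩ := hb (δ f)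
    exact ⟨a, by simpa using ha⟩

theorem le_ncard_patterns {n m : ℕ} {f : Fin n → U.F} (x : Fin m → U.A)
    (hx : ∀ i j, (∀ k, (f k).1 (x i) = (f k).1 (x j)) → i = j) : m ≤ (patterns f).ncard := by
  have h1 : Function.Injective fun i k => (f k).1 (x i) := fun i j h => hx i j (congrFun h)
  have h2 : (Set.range fun i k => (f k).1 (x i)) ⊆ patterns f := by
    rintro _ ⟨i, rfl⟩
    exact ⟨x i, rfl⟩
  calc m = (Set.range fun i k => (f k).1 (x i)).ncard := by
        rw [← Set.image_univ, Set.ncard_image_of_injective _ h1, Set.ncard_univ]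
        simp
    _ ≤ _ := Set.ncard_le_ncard h2 (Set.toFinite _)

theorem le_ncard_patterns_of_thresholds {n : ℕ} {f : Fin n → U.F} (x : Fin (n + 1) → U.A)
    (hx : ∀ i j, (f j).1 (x i) = decide (j.1 < i.1)) : n + 1 ≤ (patterns f).ncard := by
  refine le_ncard_patterns x fun i j h => ?_
  simp only [hx, decide_eq_decide] at h
  by_contra hij
  rcases lt_or_gt_of_ne hij with hlt | hlt
  · have := h ⟨i.1, by omega⟩
    simp only at this
    omega
  · have := h ⟨j.1, by omega⟩
    simp only at this
    omega

section ManyPatterns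

variable {n : ℕ} {f : Fin n → U.F}

theorem two_mul_le_La (hn : 0 < n) (hf : n + 1 ≤ (patterns f).ncard) : 2 * (n + 1) ≤ U.La n := by
  obtain ⟨Γ, hΓ, hs⟩ := exists_LaProblem (identify hn f)
  obtain ⟨V, hV, hV'⟩ := exists_values_identify hn f
  have h1 := (hΓ.card_values_le hV').1
  have h2 := LaProblem_le_La (identify hn f) (le_refl n)
  omega

theorem two_mul_le_Ld (hn : 0 < n) (hf : n + 1 ≤ (patterns f).ncard) : 2 * (n + 1) ≤ U.Ld n := by
  obtain ⟨Γ, hΓ, hs⟩ := exists_LdProblem (identify hn f)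
  obtain ⟨V, hV, hV'⟩ := exists_values_identify hn f
  have h1 := (hΓ.2.card_values_le hV').1
  have h2 := LdProblem_le_Ld (identify hn f) (le_refl n)
  omega

theorem le_two_pow_hd (hn : 0 < n) (hf : n + 1 ≤ (patterns f).ncard) : n + 1 ≤ 2 ^ U.hd n := by
  obtain ⟨Γ, hΓ, hs⟩ := exists_hdProblem (identify hn f)
  obtain ⟨V, hV, hV'⟩ := exists_values_identify hn f
  have h1 := hΓ.card_values_le hV'
  have h2 := hdProblem_le_hd (identify hn f) (le_refl n)
  rw [hs] at h1
  have h3 : 2 ^ U.hdProblem (identify hn f) ≤ 2 ^ U.hd n := Nat.pow_le_pow_right (by norm_num) h2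
  omega

end ManyPatterns

theorem PairDependent.Ld_le (h : U.PairDependent) {n : ℕ} (hn : 1 ≤ n) : U.Ld n ≤ 2 * (n + 1) :=
  sSup_problems_le hn fun z hz => (LdProblem_le_patterns z).trans
    (by have := h.ncard_patterns_le z.f; omega)

theorem PairDependent.La_le (h : U.PairDependent) {n : ℕ} (hn : 1 ≤ n) : U.La n ≤ 2 * (n + 1) :=
  sSup_problems_le hn fun z hz => (LaProblem_le_patterns z).trans
    (by have := h.ncard_patterns_le z.f; omega)

theorem hd_one_le : U.hd 1 ≤ 1 :=
  sSup_problems_le le_rfl fun z hz => by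
    obtain ⟨Γ, h, hd, -⟩ := z.exists_solvesD
    exact h.hdProblem_le.trans (hd.trans hz)

theorem hd_le_of_forall {n D : ℕ} (hn : 1 ≤ n) (hD : n + 1 ≤ 2 ^ D)
    (h : ∀ (z : U.Problem) (D : ℕ), z.dim + 1 ≤ 2 ^ D →
      ∃ Γ : DTree U, Γ.SolvesD z ∧ Γ.depth ≤ D + 1) : U.hd n ≤ D + 1 :=
  sSup_problems_le hn fun z hz => by
    obtain ⟨Γ, h, hd⟩ := h z D (by omega)
    exact h.hdProblem_le.trans hd

/-- Below, $n+1$ tuples to identify force $n+1\le 2^{h}$. Above, $D=\lfloor\log_2 n\rfloor+1$ gives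
depth at most $\log_2 n+2\le 2(\log_2 n)^{1+\varepsilon}+1$ as soon as $\log_2 n\ge 1$. -/
theorem isLOG_hd (hmany : ∀ n, 1 ≤ n → ∃ f : Fin n → U.F, n + 1 ≤ (patterns f).ncard)
    (h : ∀ (z : U.Problem) (D : ℕ), z.dim + 1 ≤ 2 ^ D →
      ∃ Γ : DTree U, Γ.SolvesD z ∧ Γ.depth ≤ D + 1) : IsLOG U.hd := by
  intro ε h0 h1
  refine ⟨2, by norm_num, fun n hn => ⟨?_, ?_⟩⟩
  · obtain ⟨f, hf⟩ := hmany n hn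
    rw [Real.logb_le_iff_le_rpow (by norm_num) (by positivity), Real.rpow_natCast]
    exact_mod_cast le_two_pow_hd hn hf
  -- For $n=1$ the logarithm vanishes and only the additive 1 remains.
  · rcases hn.eq_or_lt with rfl | hn2
    · have : (U.hd 1 : ℝ) ≤ 1 := by exact_mod_cast hd_one_le
      simpa [Real.zero_rpow (by linarith : 1 + ε ≠ 0)] using this
    · have hlog : (Nat.log 2 n : ℝ) ≤ Real.logb 2 n := by
        rw [Real.le_logb_iff_rpow_le (by norm_num) (by positivity), Real.rpow_natCast]
        exact_mod_cast Nat.pow_log_le_self 2 (by omega)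
      have hone : 1 ≤ Real.logb 2 n := by
        rw [Real.le_logb_iff_rpow_le (by norm_num) (by positivity), Real.rpow_one]
        exact_mod_cast hn2
      have hpow : Real.logb 2 n ≤ (Real.logb 2 n) ^ (1 + ε) := by
        conv_lhs => rw [← Real.rpow_one (Real.logb 2 n)]
        exact Real.rpow_le_rpow_of_exponent_le hone (by linarith)
      have hhd : U.hd n ≤ Nat.log 2 n + 1 + 1 :=
        hd_le_of_forall hn (Nat.lt_pow_succ_log_self (by norm_num) n) h
      have : (U.hd n : ℝ) ≤ Nat.log 2 n + 1 + 1 := by exact_mod_cast hhd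
      linarith

/-- Dependence of pairs pins $I(U)=1$ and bounds both node counts by $2(n+1)\le 2\cdot 4n$; the
bounded nondeterministic depth comes for free from LOG. -/
theorem PairDependent.inW1 (hdep : U.PairDependent) {f : U.A → Bool} (hf : f ∈ U.F)
    (hb : ∀ b, ∃ a, f a = b)
    (hmany : ∀ n, 1 ≤ n → ∃ f : Fin n → U.F, n + 1 ≤ (patterns f).ncard)
    (h : ∀ (z : U.Problem) (D : ℕ), z.dim + 1 ≤ 2 ^ D →
      ∃ Γ : DTree U, Γ.SolvesD z ∧ Γ.depth ≤ D + 1) : U.InW1 := by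
  have hlog := isLOG_hd hmany h
  refine ⟨hlog, isCON_ha_of_isLOG_hd hlog, ⟨1, hdep.iDim_eq_one hf hb, fun n hn => ⟨?_, ?_⟩⟩,
    ⟨1, hdep.iDim_eq_one hf hb, fun n hn => ⟨?_, ?_⟩⟩⟩
  · obtain ⟨f, hf⟩ := hmany n hn
    exact two_mul_le_Ld hn hf
  · have := hdep.Ld_le hn
    rw [pow_one]
    omega
  · obtain ⟨f, hf⟩ := hmany n hn
    exact two_mul_le_La hn hf
  · have := hdep.La_le hn
    rw [pow_one]
    omega

/-! ### Binary search -/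

/-- Binary search along a decreasing chain of attributes. -/
theorem Node.exists_binary_search {val : U.A → ℕ+} {d s : ℕ} (D : ℕ) (gs : List U.F)
    (hgs : gs.Pairwise fun g g' => ∀ a, g'.1 a = true → g.1 a = true)
    (hD : gs.length + 1 ≤ 2 ^ D) (X : Set U.A)
    (hcell : ∀ Y ⊆ X, (∀ g ∈ gs, ∃ b, ∀ a ∈ Y, g.1 a = b) →
      ∃ v : Node U, v.Deterministic ∧ v.Computes Y val ∧ v.depth ≤ d ∧ v.size ≤ s) :
    ∃ v : Node U, v.Deterministic ∧ v.Computes X val ∧ v.depth ≤ D + d ∧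
      v.size ≤ gs.length + (gs.length + 1) * s := by
  induction D generalizing gs X with
  | zero =>
    have : gs = [] := List.eq_nil_of_length_eq_zero (by simpa using hD)
    subst this
    simpa using hcell X subset_rfl (by simp)
  | succ D ih =>
    rcases Nat.eq_zero_or_pos gs.length with h0 | hpos
    · have : gs = [] := List.eq_nil_of_length_eq_zero h0
      subst this
      obtain ⟨v, h1, h2, h3, h4⟩ := hcell X subset_rfl (by simp)
      exact ⟨v, h1, h2, by omega, by simpa using h4⟩
    -- Querying the middle attribute leaves at most $2^D-1$ undecided ones: the answer 0 falsifies
    -- all later attributes of the chain, the answer 1 verifies all earlier ones.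
    · have hsplit : ∃ l g r, gs = l ++ g :: r ∧ l.length + 1 ≤ 2 ^ D ∧ r.length + 1 ≤ 2 ^ D := by
        have hk : gs.length / 2 < gs.length := by omega
        rw [pow_succ] at hD
        refine ⟨gs.take (gs.length / 2), gs[gs.length / 2], gs.drop (gs.length / 2 + 1), ?_, ?_, ?_⟩
        · rw [← List.drop_eq_getElem_cons, List.take_append_drop]
        · rw [List.length_take]
          omega
        · rw [List.length_drop]
          omega
      obtain ⟨l, g, r, rfl, hl, hr⟩ := hsplit
      obtain ⟨pl, pgr, plr⟩ := List.pairwise_append.1 hgs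
      obtain ⟨pg, pr⟩ := List.pairwise_cons.1 pgr
      obtain ⟨v0, a1, a2, a3, a4⟩ := ih l pl hl {a ∈ X | g.1 a = false} fun Y hY hc => by
        refine hcell Y (fun a ha => (hY ha).1) fun k hk => ?_
        rcases List.mem_append.1 hk with hk | hk
        · exact hc k hk
        · refine ⟨false, fun a ha => ?_⟩
          rcases List.mem_cons.1 hk with rfl | hk
          · exact (hY ha).2
          · by_contra hka
            have := pg k hk a (by simpa using hka)
            rw [(hY ha).2] at this
            simp at this
      obtain ⟨v1, b1, b2, b3, b4⟩ := ih r pr hr {a ∈ X | g.1 a = true} fun Y hY hc => by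
        refine hcell Y (fun a ha => (hY ha).1) fun k hk => ?_
        rcases List.mem_append.1 hk with hk | hk
        · exact ⟨true, fun a ha => plr k hk g (List.mem_cons_self ..) a (hY ha).2⟩
        · rcases List.mem_cons.1 hk with rfl | hk
          · exact ⟨true, fun a ha => (hY ha).2⟩
          · exact hc k hk
      refine ⟨.query g fun b => bif b then v1 else v0, deterministic_query ?_, computes_query ?_,
        ?_, ?_⟩
      · rintro (_ | _) <;> assumption
      · rintro (_ | _) <;> assumption
      · simp only [depth_query, cond_true, cond_false]
        omega
      · simp only [size_query, cond_true, cond_false, List.length_append, List.length_cons]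
        nlinarith

theorem Problem.value_eq_of_agree (z : U.Problem) {a b : U.A}
    (h : ∀ k, (z.f k).1 a = (z.f k).1 b) : z.value a = z.value b := by
  unfold Problem.value
  congr 1
  exact funext h

theorem Problem.exists_terminal (z : U.Problem) {Y : Set U.A}
    (h : ∀ a ∈ Y, ∀ b ∈ Y, ∀ k, (z.f k).1 a = (z.f k).1 b) :
    ∃ s, (Node.terminal s : Node U).Computes Y z.value := by
  rcases Y.eq_empty_or_nonempty with rfl | ⟨b, hb⟩
  · exact ⟨1, Node.computes_terminal (by simp)⟩
  · exact ⟨z.value b, Node.computes_terminal fun a ha => z.value_eq_of_agree (h a ha b hb)⟩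

/-- Binary search along the attributes `q i`, `i ∈ S`. -/
theorem Problem.exists_solvesD_of_chain (z : U.Problem) {q : ℕ+ → U.F}
    (hq : ∀ i j, i ≤ j → ∀ a, (q j).1 a = true → (q i).1 a = true) {S : Finset ℕ+} {D d s : ℕ}
    (hS : S.card ≤ z.dim) (hD : z.dim + 1 ≤ 2 ^ D)
    (hcell : ∀ Y : Set U.A, (∀ i ∈ S, ∀ a ∈ Y, ∀ b ∈ Y, (q i).1 a = (q i).1 b) →
      ∃ v : Node U, v.Deterministic ∧ v.Computes Y z.value ∧ v.depth ≤ d ∧ v.size ≤ s) :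
    ∃ Γ : DTree U, Γ.SolvesD z ∧ Γ.depth ≤ D + d ∧ Γ.size ≤ (z.dim + 1) * (s + 1) := by
  have hlen : ((S.sort (· ≤ ·)).map q).length = S.card := by simp
  obtain ⟨v, h1, h2, h3, h4⟩ := Node.exists_binary_search (val := z.value) (d := d) (s := s) D
    ((S.sort (· ≤ ·)).map q)
    (List.pairwise_map.2 ((S.pairwise_sort (· ≤ ·)).imp fun {i j} h => hq i j h))
    (by rw [hlen]; omega) Set.univ (fun Y _ hY => hcell Y fun i hi a ha b hb => by
      obtain ⟨c, hc⟩ := hY (q i) (List.mem_map.2 ⟨i, (Finset.mem_sort _).2 hi, rfl⟩)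
      rw [hc a ha, hc b hb])
  refine ⟨.single v, DTree.solvesD_single h1 h2, by rwa [DTree.depth_single], ?_⟩
  rw [DTree.size_single]
  rw [hlen] at h4
  have := Nat.mul_le_mul_right s (Nat.succ_le_succ hS)
  simp only [Nat.succ_eq_add_one] at this
  rw [Nat.mul_add]
  omega

/-! ### The system $U_1$ -/

section ThresholdSystem

/-- The attribute `l_i` as an element of the attribute set. -/
def thresholdL (i : ℕ+) : U₁.F := ⟨attrL i, i, rfl⟩

theorem pairDependent_U₁ : U₁.PairDependent := by
  have key : ∀ i j : ℕ+, i < j → ∀ a, ¬ (attrL i a = false ∧ attrL j a = true) := by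
    rintro i j hij a ⟨h1, h2⟩
    simp only [attrL, decide_eq_false_iff_not, decide_eq_true_eq] at h1 h2
    exact h1 (hij.trans h2)
  rintro _ ⟨i, rfl⟩ _ ⟨j, rfl⟩ hne
  rcases lt_trichotomy i j with h | rfl | h
  · exact ⟨false, true, key i j h⟩
  · exact absurd rfl hne
  · exact ⟨true, false, fun a ha => key j i h a ha.symm⟩

theorem exists_patterns_U₁ (n : ℕ) : ∃ f : Fin n → U₁.F, n + 1 ≤ (patterns f).ncard := by
  refine ⟨fun j => thresholdL (Nat.succPNat j),
    le_ncard_patterns_of_thresholds (fun i => Nat.succPNat i) fun i j => ?_⟩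
  simp [thresholdL, attrL, ← PNat.coe_lt_coe]

/-- The attributes of the problem are themselves the chain searched, so every cell is a single
terminal node. -/
theorem exists_solvesD_U₁ (z : U₁.Problem) {D : ℕ} (hD : z.dim + 1 ≤ 2 ^ D) :
    ∃ Γ : DTree U₁, Γ.SolvesD z ∧ Γ.depth ≤ D ∧ Γ.size ≤ 2 * (z.dim + 1) := by
  choose i hi using fun k => (z.f k).2
  have hchain : ∀ i j, i ≤ j → ∀ a, (thresholdL j).1 a = true → (thresholdL i).1 a = true := by
    intro i j hij a h
    have h : attrL j a = true := h
    change attrL i a = true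
    simp only [attrL, decide_eq_true_eq] at h ⊢
    exact hij.trans_lt h
  obtain ⟨Γ, h1, h2, h3⟩ := z.exists_solvesD_of_chain hchain (S := Finset.univ.image i) (d := 0)
    (s := 1) (Finset.card_image_le.trans (by simp)) hD fun Y hY => by
      obtain ⟨s, hs⟩ := z.exists_terminal (Y := Y) fun a ha b hb k => by
        rw [← hi k]
        exact hY (i k) (by simp) a ha b hb
      exact ⟨.terminal s, trivial, hs, by simp [Node.depth], by simp [Node.size]⟩
  exact ⟨Γ, h1, h2, by omega⟩

theorem inW1_U₁ : U₁.InW1 := by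
  refine pairDependent_U₁.inW1 (f := attrL 1) ⟨1, rfl⟩ ?_ (fun n _ => exists_patterns_U₁ n)
    fun z D hD => ?_
  · rintro (_ | _)
    · exact ⟨(1 : ℕ+), by simp [attrL]⟩
    · exact ⟨(2 : ℕ+), by simp [attrL]⟩
  · obtain ⟨Γ, h1, h2, -⟩ := exists_solvesD_U₁ z hD
    exact ⟨Γ, h1, h2.trans (Nat.le_succ D)⟩

/-- A family realizing $n+1$ tuples gives $n+1\le 2^{h^d(n)}$ and $2(n+1)\le L^d(n)$. Binary search
with $D=h^d(n)$ therefore meets both bounds in one tree. -/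
theorem dReachable_U₁ : U₁.DReachable := by
  intro z
  obtain ⟨f, hf⟩ := exists_patterns_U₁ z.dim
  obtain ⟨Γ, h1, h2, h3⟩ := exists_solvesD_U₁ z (le_two_pow_hd z.dim_pos hf)
  exact ⟨Γ, h1, Nat.cast_le.2 h2, Nat.cast_le.2 (h3.trans (two_mul_le_Ld z.dim_pos hf))⟩

end ThresholdSystem

/-! ### The system $U_6$ -/

section PointThresholdSystem

/-- The attribute `p_i` as an element of the attribute set. -/
noncomputable def pointP (i : ℕ+) : U₆.F := ⟨attrP i, .inl ⟨i, rfl⟩⟩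

/-- The attribute `q_i` as an element of the attribute set. -/
noncomputable def thresholdQ (i : ℕ+) : U₆.F := ⟨attrQ i, .inr ⟨i, rfl⟩⟩

theorem attrP_eq_true {i : ℕ+} {a : ℝ≥0} : attrP i a = true ↔ a = ((i : ℕ) : ℝ≥0) := by
  simp [attrP]

theorem attrQ_eq_true {i : ℕ+} {a : ℝ≥0} :
    attrQ i a = true ↔ ((i : ℕ) : ℝ) + 1 / 2 ≤ (a : ℝ) := by
  simp [attrQ, ← NNReal.coe_le_coe]

theorem attrQ_mono {i j : ℕ+} (h : i ≤ j) {a : ℝ≥0} (ha : attrQ j a = true) :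
    attrQ i a = true := by
  rw [attrQ_eq_true] at *
  have : ((i : ℕ) : ℝ) ≤ (j : ℕ) := by exact_mod_cast h
  linarith

theorem attrQ_natCast {i : ℕ+} {m : ℕ} : attrQ i (m : ℝ≥0) = true ↔ (i : ℕ) < m := by
  rw [attrQ_eq_true, NNReal.coe_natCast]
  constructor
  · intro h
    have : ((i : ℕ) : ℝ) < m := by linarith
    exact_mod_cast this
  · intro h
    have : ((i : ℕ) : ℝ) + 1 ≤ m := by exact_mod_cast h
    linarith

theorem attrQ_eq_of_near {i : ℕ+} {m : ℕ} {a : ℝ≥0} (h1 : (m : ℝ) ≤ a) (h2 : (a : ℝ) < m + 1 / 2) :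
    attrQ i (m : ℝ≥0) = attrQ i a := by
  rw [Bool.eq_iff_iff, attrQ_natCast, attrQ_eq_true]
  constructor
  · intro h
    have : ((i : ℕ) : ℝ) + 1 ≤ m := by exact_mod_cast h
    linarith
  · intro h
    have : ((i : ℕ) : ℝ) < m := by linarith
    exact_mod_cast this

/-- The sets where $q_i=1$ are nested, and $p_i=1$ holds at a single object, which fixes every other
attribute. -/
theorem pairDependent_U₆ : U₆.PairDependent := by
  have hQ : ∀ i j : ℕ+, i < j → ∀ a, ¬ (attrQ i a = false ∧ attrQ j a = true) := by
    rintro i j hij a ⟨h1, h2⟩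
    rw [attrQ_mono hij.le h2] at h1
    simp at h1
  have hPQ : ∀ i j : ℕ+, ∃ ε, ∀ a, ¬ (attrP i a = true ∧ attrQ j a = ε) := by
    intro i j
    refine ⟨!(attrQ j ((i : ℕ) : ℝ≥0)), ?_⟩
    rintro a ⟨h1, h2⟩
    rw [attrP_eq_true.1 h1] at h2
    simp at h2
  rintro _ (⟨i, rfl⟩ | ⟨i, rfl⟩) _ (⟨j, rfl⟩ | ⟨j, rfl⟩) hne
  · refine ⟨true, true, ?_⟩
    rintro a ⟨h1, h2⟩
    have h3 := (attrP_eq_true.1 h1).symm.trans (attrP_eq_true.1 h2)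
    rw [Nat.cast_inj, PNat.coe_inj] at h3
    exact hne (h3 ▸ rfl)
  · obtain ⟨ε, h⟩ := hPQ i j
    exact ⟨true, ε, h⟩
  · obtain ⟨ε, h⟩ := hPQ j i
    exact ⟨ε, true, fun a ha => h a ha.symm⟩
  · rcases lt_trichotomy i j with h | rfl | h
    · exact ⟨false, true, hQ i j h⟩
    · exact absurd rfl hne
    · exact ⟨true, false, fun a ha => hQ j i h a ha.symm⟩

theorem exists_patterns_U₆ (n : ℕ) : ∃ f : Fin n → U₆.F, n + 1 ≤ (patterns f).ncard := by
  refine ⟨fun j => thresholdQ (Nat.succPNat j),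
    le_ncard_patterns_of_thresholds (fun i => ((i.1 + 1 : ℕ) : ℝ≥0)) fun i j => ?_⟩
  change attrQ (Nat.succPNat j) ((i.1 + 1 : ℕ) : ℝ≥0) = _
  rw [Bool.eq_iff_iff, attrQ_natCast]
  simp

/-- Each $p_i$ in the problem is first replaced by the threshold $q_i$. After the search at most one
of the points $i$ is left in a cell, so one further query suffices. -/
theorem exists_solvesD_U₆ (z : U₆.Problem) {D : ℕ} (hD : z.dim + 1 ≤ 2 ^ D) :
    ∃ Γ : DTree U₆, Γ.SolvesD z ∧ Γ.depth ≤ D + 1 := by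
  have hidx : ∀ k, ∃ i : ℕ+, z.f k = pointP i ∨ z.f k = thresholdQ i := by
    intro k
    rcases (z.f k).2 with ⟨i, hi⟩ | ⟨i, hi⟩
    · exact ⟨i, .inl (Subtype.ext hi.symm)⟩
    · exact ⟨i, .inr (Subtype.ext hi.symm)⟩
  choose i hi using hidx
  obtain ⟨Γ, h1, h2, -⟩ := z.exists_solvesD_of_chain (q := thresholdQ)
    (fun i j hij a h => attrQ_mono hij h) (S := Finset.univ.image i) (d := 1) (s := 3)
    (Finset.card_image_le.trans (by simp)) hD fun (Y : Set ℝ≥0) hY => by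
      have hY' : ∀ k, ∀ a ∈ Y, ∀ b ∈ Y, attrQ (i k) a = attrQ (i k) b :=
        fun k => hY (i k) (by simp)
      by_cases hp : ∃ k, ∃ a ∈ Y, z.f k = pointP (i k) ∧ attrP (i k) a = true
      · obtain ⟨k, a, ha, hk, hka⟩ := hp
        rw [attrP_eq_true] at hka
        -- Among integers, $q_i$ jumps between $i$ and $i+1$; two different indices in one cell
        -- would be separated by the threshold of the smaller.
        have hother : ∀ l, ∀ b ∈ Y, attrP (i l) b = true → i l = i k := by
          intro l b hb hlb
          rw [attrP_eq_true] at hlb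
          have e1 := Bool.eq_iff_iff.1 (hY' k a ha b hb)
          have e2 := Bool.eq_iff_iff.1 (hY' l a ha b hb)
          rw [hka, hlb, attrQ_natCast, attrQ_natCast] at e1 e2
          exact PNat.coe_injective (by omega)
        have hcell : ∀ b : Bool, ∃ s, (Node.terminal s : Node U₆).Computes
            {a ∈ Y | (z.f k).1 a = b} z.value := by
          intro b
          refine z.exists_terminal ?_
          rintro x ⟨hx, hxb⟩ y ⟨hy, hyb⟩ l
          rcases hi l with hl | hl
          · by_cases hlk : i l = i k
            · rw [hl, hlk, ← hk, hxb, hyb]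
            · rw [hl]
              change attrP (i l) x = attrP (i l) y
              have hx' := mt (hother l x hx) hlk
              have hy' := mt (hother l y hy) hlk
              rw [Bool.not_eq_true] at hx' hy'
              rw [hx', hy']
          · rw [hl]
            exact hY' l x hx y hy
        choose s hs using hcell
        exact ⟨.query (z.f k) fun b => .terminal (s b), Node.deterministic_query fun _ => trivial,
          Node.computes_query hs, by simp [Node.depth_query, Node.depth],
          by simp [Node.size_query, Node.size]⟩
      · push Not at hp
        obtain ⟨s, hs⟩ := z.exists_terminal (Y := Y) fun a ha b hb k => by
          rcases hi k with hk | hk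
          · have h1 := hp k a ha hk
            have h2 := hp k b hb hk
            rw [hk]
            exact (Bool.eq_false_of_not_eq_true h1).trans (Bool.eq_false_of_not_eq_true h2).symm
          · rw [hk]
            exact hY' k a ha b hb
        exact ⟨.terminal s, trivial, hs, by simp [Node.depth], by simp [Node.size]⟩
  exact ⟨Γ, h1, h2⟩

theorem inW1_U₆ : U₆.InW1 := by
  refine pairDependent_U₆.inW1 (f := attrP 1) (.inl ⟨1, rfl⟩) ?_ (fun n _ => exists_patterns_U₆ n)
    fun z D hD => exists_solvesD_U₆ z hD
  rintro (_ | _)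
  · exact ⟨(0 : ℝ≥0), by simp [attrP]⟩
  · exact ⟨(1 : ℝ≥0), by simp [attrP]⟩

theorem pointP_injective : Function.Injective pointP := fun _ _ h =>
  attrP_injective (congrArg Subtype.val h)

/-- Only `p_i` separates `i` from `i + 1/4`. -/
theorem eq_pointP_of_separates {g : U₆.F} {i : ℕ+}
    (h : g.1 ((i : ℕ) : ℝ≥0) ≠ g.1 (((i : ℕ) : ℝ≥0) + 1 / 4 : ℝ≥0)) : g = pointP i := by
  rcases g with ⟨_, ⟨j, rfl⟩ | ⟨j, rfl⟩⟩
  · have hne : attrP j (((i : ℕ) : ℝ≥0) + 1 / 4 : ℝ≥0) = false := by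
      rw [← Bool.not_eq_true, attrP_eq_true, ← NNReal.coe_inj]
      push_cast
      intro hc
      have h1 : ((i : ℕ) : ℝ) < (j : ℕ) := by linarith
      have h2 : ((j : ℕ) : ℝ) < (i : ℕ) + 1 := by linarith
      have h3 : (i : ℕ) < (j : ℕ) := by exact_mod_cast h1
      have h4 : (j : ℕ) < (i : ℕ) + 1 := by exact_mod_cast h2
      omega
    have : attrP j ((i : ℕ) : ℝ≥0) = true := by
      by_contra hc
      rw [Bool.not_eq_true] at hc
      exact h (hc.trans hne.symm)
    rw [attrP_eq_true, Nat.cast_inj, PNat.coe_inj] at this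
    exact this ▸ rfl
  · refine absurd (attrQ_eq_of_near ?_ ?_) h <;> push_cast <;> linarith

/-- Identify $p_1,\dots,p_{16}$. Any $n$ larger than $\lceil\log_2(n+1)\rceil+1$ would serve in
place of 16. -/
theorem not_dReachable_U₆ : ¬ U₆.DReachable := by
  classical
  intro h
  let f : Fin 16 → U₆.F := fun j => pointP (Nat.succPNat j)
  have hf : Function.Injective f := fun i j hij =>
    Fin.ext (Nat.succPNat_injective (pointP_injective hij))
  have hfv : ∀ (j : Fin 16) (a : ℝ≥0), (f j).1 a = true ↔ a = ((j.1 + 1 : ℕ) : ℝ≥0) :=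
    fun j a => attrP_eq_true
  have hpat : 17 ≤ (patterns f).ncard := by
    refine le_ncard_patterns (fun i : Fin 17 => ((i : ℕ) : ℝ≥0)) fun i j hij => ?_
    have hk : ∀ k : Fin 16, (i : ℕ) = k + 1 ↔ (j : ℕ) = k + 1 := by
      intro k
      have := Bool.eq_iff_iff.1 (hij k)
      rwa [hfv, hfv, Nat.cast_inj, Nat.cast_inj] at this
    apply Fin.ext
    rcases Nat.eq_zero_or_pos i with h0 | h0
    · rcases Nat.eq_zero_or_pos j with h1 | h1
      · omega
      · have := hk ⟨j - 1, by omega⟩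
        simp only at this
        omega
    · have := hk ⟨i - 1, by omega⟩
      simp only at this
      omega
  let z := identify (by norm_num : 0 < 16) f
  obtain ⟨V, hV, hV'⟩ := exists_values_identify (by norm_num : 0 < 16) f
  obtain ⟨Γ, hΓ, hd, hs⟩ := h z
  -- The depth bound is $5+1$ because $17\le 2^5$, and the node bound below is $2\cdot 17$.
  have hd : Γ.depth ≤ 6 := (Nat.cast_le.1 hd).trans
    (hd_le_of_forall (n := 16) (D := 5) (by norm_num) (by norm_num)
      fun z D hD => exists_solvesD_U₆ z hD)
  have hs : Γ.size ≤ 34 := (Nat.cast_le.1 hs).trans (pairDependent_U₆.Ld_le (n := 16) (by norm_num))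
  obtain ⟨v, hv, hc, hvs, hvd⟩ := hΓ.exists_node
  have hpaths : 17 ≤ v.paths.card := by
    have hsub : V ⊆ (v.paths.map Prod.snd).toFinset := by
      intro t ht
      obtain ⟨a, rfl⟩ := hV' t ht
      obtain ⟨⟨e, s, hp, hs⟩, hu⟩ := hc a trivial
      obtain rfl := hu e s hp hs
      exact Multiset.mem_toFinset.2 (Multiset.mem_map.2 ⟨_, Node.mem_paths.2 hp, rfl⟩)
    have h1 := (Finset.card_le_card hsub).trans (Multiset.toFinset_card_le _)
    rw [Multiset.card_map] at h1
    omega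
  -- Without the root at most 33 nodes remain, of which at least 17 are terminal.
  have hattrs : v.attrs.card ≤ 16 := by
    have := v.size_eq
    omega
  have hsep : ∀ a b : ℝ≥0, ∀ j, (f j).1 a ≠ (f j).1 b → z.value a ≠ z.value b :=
    fun a b j hj hab => hj (identify_value_inj hab j)
  have hpath : ∀ a : ℝ≥0, ∃ e, v.IsPath e (z.value a) ∧ a ∈ U₆.solutions e := by
    intro a
    obtain ⟨⟨e, s, hp, hs⟩, hu⟩ := hc a trivial
    obtain rfl := hu e s hp hs
    exact ⟨e, hp, hs⟩
  have hmem : ∀ j, f j ∈ v.attrs := by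
    intro j
    obtain ⟨e, hp, hs⟩ := hpath ((j.1 + 1 : ℕ) : ℝ≥0)
    have hne : (f j).1 ((j.1 + 1 : ℕ) : ℝ≥0) ≠ (f j).1 (((j.1 + 1 : ℕ) : ℝ≥0) + 1 / 4 : ℝ≥0) := by
      intro heq
      rw [(hfv j _).2 rfl] at heq
      simpa using (hfv j _).1 heq.symm
    obtain ⟨p, hpe, hpne⟩ := hc.exists_separating (Set.mem_univ _) (hsep _ _ j hne) hp hs
    have : p.1 = f j := eq_pointP_of_separates (i := Nat.succPNat j) hpne
    exact this ▸ hp.mem_attrs hpe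
  -- All 16 attributes must occur, each being the only one to separate its point $i$ from
  -- $i+\tfrac14$. With at most 16 working nodes, no threshold fits in.
  have hall : v.attrs.toFinset = Finset.univ.image f := by
    refine (Finset.eq_of_subset_of_card_le ?_ ?_).symm
    · intro g hg
      obtain ⟨j, -, rfl⟩ := Finset.mem_image.1 hg
      exact Multiset.mem_toFinset.2 (hmem j)
    · rw [Finset.card_image_of_injective _ hf]
      simpa using (Multiset.toFinset_card_le _).trans hattrs
  -- The path of the object 0 must separate it from each of the points 1 to 16. Every $p_k$ is 0 at
  -- 0, so separating 0 from a point takes that point's own attribute; the path thus has length at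
  -- least 16.
  obtain ⟨e, hp, hs0⟩ := hpath 0
  have hsub : Finset.univ.image f ⊆ (e.map Prod.fst).toFinset := by
    intro g hg
    obtain ⟨j, -, rfl⟩ := Finset.mem_image.1 hg
    have hz0 : ∀ k, (f k).1 (0 : ℝ≥0) = false := by
      intro k
      rw [← Bool.not_eq_true, hfv]
      exact fun h0 => Nat.cast_ne_zero.2 (Nat.succ_ne_zero k.1) h0.symm
    have hne : (f j).1 (0 : ℝ≥0) ≠ (f j).1 ((j.1 + 1 : ℕ) : ℝ≥0) := by
      rw [hz0, (hfv j _).2 rfl]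
      simp
    obtain ⟨p, hpe, hpne⟩ := hc.exists_separating (Set.mem_univ _) (hsep _ _ j hne) hp hs0
    have hpa : p.1 ∈ Finset.univ.image f := hall ▸ Multiset.mem_toFinset.2 (hp.mem_attrs hpe)
    obtain ⟨k, -, hk⟩ := Finset.mem_image.1 hpa
    rw [← hk, hz0] at hpne
    have hkj : (f k).1 ((j.1 + 1 : ℕ) : ℝ≥0) = true := by
      cases hfk : (f k).1 ((j.1 + 1 : ℕ) : ℝ≥0)
      · exact absurd hfk.symm hpne
      · rfl
    rw [hfv, Nat.cast_inj] at hkj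
    obtain rfl : j = k := Fin.ext (by omega)
    exact List.mem_toFinset.2 (List.mem_map.2 ⟨p, hpe, hk.symm⟩)
  have h16 := (Finset.card_le_card hsub).trans (List.toFinset_card_le _)
  rw [Finset.card_image_of_injective _ hf, List.length_map] at h16
  have hlen := hp.length_le_depth
  simp only [Finset.card_univ, Fintype.card_fin] at h16
  omega

end PointThresholdSystem

end InfoSystem

theorem theorem2 :
    -- (a) existence
    (InfoSystem.U₁.InW1 ∧ InfoSystem.U₁.DReachable) ∧
    (InfoSystem.U₆.InW1 ∧ ¬ InfoSystem.U₆.DReachable) ∧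
    -- (a) boundary `d`-pairs
    (∀ U : InfoSystem.{u}, U.InW1 → ¬ U.DReachable → ∀ ε : ℝ, 0 < ε → ε < 1 →
      ∃ c : ℝ, 0 < c ∧
        U.IsBoundaryDPair
          (fun n => c * (Real.logb 2 n) ^ (1 + ε) + 1)
          (fun n => (2 : ℝ) ^ (c * (Real.logb 2 n) ^ (1 + ε) + 2))) ∧
    -- (b)
    (∀ U : InfoSystem.{u}, U.InW1 →
      ¬ U.AReachable ∧
      ∀ ε : ℝ, 0 < ε → ε < 1 →
        ∃ c₁ c₂ c₃ : ℝ, 0 < c₁ ∧ 0 < c₂ ∧ 0 < c₃ ∧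
          U.IsBoundaryAPair
            (fun _ => c₁)
            (fun n => (2 : ℝ) ^ (c₂ * (Real.logb 2 n) ^ (1 + ε) + c₃))) := by
  refine ⟨⟨InfoSystem.inW1_U₁, InfoSystem.dReachable_U₁⟩,
    ⟨InfoSystem.inW1_U₆, InfoSystem.not_dReachable_U₆⟩,
    fun U hU _ ε h0 h1 => hU.1.exists_boundaryDPair h0 h1,
    fun U hU => ⟨?_, fun ε h0 h1 => hU.1.exists_boundaryAPair h0 h1⟩⟩
  obtain ⟨-, ⟨c, -, hc⟩, -, d, -, hL⟩ := hU
  -- Depths are integers, so the real bound may be replaced by its floor.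
  exact InfoSystem.not_AReachable (c := ⌊c⌋₊) (fun n hn => Nat.le_floor (hc n hn))
    fun n hn => (hL n hn).1
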